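/- Let $\kappa\neq 0$, $\varepsilon\in\{1,-1\}$, and let $\mathbb M^2(\kappa)$ be the complete simply connected surface of curvature $\kappa$ with metric $d\sigma^2$. Equip $\mathbb M^2(\kappa)\times\mathbb R$ with the metric $d\sigma^2+\varepsilon\,dt^2$, and let $(\rho,\theta,t)$ be cylindrical coordinates about an axis $\{p_0\}\times\mathbb R$. Put $\mathrm{sn}_\kappa(x)=\sin(\sqrt\kappa x)/\sqrt\kappa$ for $\kappa>0$, $\mathrm{sn}_\kappa(x)=\sinh(\sqrt{-\kappa}x)/\sqrt{-\kappa}$ for $\kappa<0$, and $\mathrm{cs}_\kappa=\mathrm{sn}_\kappa'$. Consider a revolution surface $X(s,\theta)=(\rho(s),\theta,t(s))$, where $s$ runs through a nonempty open interval, $(\rho,t)$ is of class $C^2$ and stays off the axis ($0<\rho$, and $\rho<\pi/\sqrt\kappa$ if $\kappa>0$), and the induced metric is Riemannian, i.e. $\dot\rho^2+\varepsilon\dot t^2>0$. Let $W=\mathrm{sn}_\kappa(\rho)\sqrt{\dot\rho^2+\varepsilon\dot t^2}$, let $n=W^{-1}\mathrm{sn}_\kappa(\rho)(\dot t\,\partial_\rho-\varepsilon\dot\rho\,\partial_t)$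 be the unit normal, let the mean curvature be half the trace of the second fundamental form $\langle D_vw,n\rangle$, and let $Q=2H\Psi^1-\varepsilon\frac{\epsilon}{r}\Psi^2$ with $\epsilon=\mathrm{sgn}\,\kappa$, $r=|\kappa|^{-1/2}$. Here, for $\mathbb M^2(\kappa)\times\mathbb R\subset\mathbb R^4$ ($\mathbb M^2(\kappa)$ being a sphere, or a sheet of a hyperboloid, $\langle p,p\rangle=1/\kappa$), $\Psi^1,\Psi^2$ are the Hopf differentials $\big(\tfrac12(h(\partial_u,\partial_u)-h(\partial_v,\partial_v))-i\,h(\partial_u,\partial_v)\big)(du+i\,dv)^2$, in conformal coordinates $u,v$, of the second fundamental forms $h$ with respect to the normals $n$ and $p/r$. (i) If the mean curvature is a constant $H$, then there is a unique constant $I$ with $$\frac{\dot t\,\mathrm{sn}_\kappa^2(\rho)}{W}=I+\frac{2H}{\kappa}\,\mathrm{cs}_\kappa(\rho)$$ (the first integral of the mean curvature equation), and $Q=0$ if and only if $I=-2H/\kappa$ or $I=2H/\kappa$. (ii) Let $H\ne0$ and $c=\sqrt{|\varepsilon+\kappa/4H^2|}$. The surface has, for one choice of sign $H'=\pm H$,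 constant mean curvature $H'$, $Q=0$ and $I=-2H'/\kappa$ if and only if, after a translation of $t$, its profile curve satisfies identically - for $\varepsilon=1$, $4H^2\varepsilon+\kappa>0$: $(4H^2\varepsilon+\kappa)\,\mathrm{sn}_\kappa^2(\rho/2)+4H^2\varepsilon\,\mathrm{sn}_{-\kappa}^2(ct/2)=1$; - for $\varepsilon=-1$, $4H^2\varepsilon+\kappa>0$: $4H^2\varepsilon\kappa\,\mathrm{sn}_{-\kappa}^2(ct/2)=-(4H^2\varepsilon+\kappa)\,\mathrm{cs}_\kappa^2(\rho/2)$; - for $\varepsilon=-1$, $4H^2\varepsilon+\kappa<0$: $(4H^2\varepsilon+\kappa)\,\mathrm{sn}_\kappa^2(\rho/2)-4H^2\varepsilon\,\mathrm{sn}_\kappa^2(ct/2)=1$; - for $\varepsilon=1$, $4H^2\varepsilon+\kappa<0$: $4H^2\varepsilon\kappa\,\mathrm{sn}_\kappa^2(ct/2)=(4H^2\varepsilon+\kappa)\,\mathrm{cs}_\kappa^2(\rho/2)$; - for $4H^2\varepsilon+\kappa=0$: $t^2=\epsilon\frac4\kappa\,\mathrm{cs}_\kappa^2(\rho/2)$.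 It has, for one choice of sign $H'=\pm H$, constant mean curvature $H'$, $Q=0$ and $I=2H'/\kappa$ if and only if, after a translation of $t$, its profile curve satisfies identically - for $\varepsilon=1$, $\kappa>0$: $(4H^2\varepsilon+\kappa)\,\kappa\,\mathrm{sn}_\kappa^2(\rho/2)=4H^2\varepsilon\,\mathrm{cs}_{-\kappa}^2(ct/2)$; - for $\varepsilon=-1$, $\kappa>0$, $4H^2\varepsilon+\kappa>0$: $(4H^2\varepsilon+\kappa)\,\mathrm{sn}_\kappa^2(\rho/2)=-4H^2\varepsilon\,\mathrm{sn}_{-\kappa}^2(ct/2)$; - for $4H^2\varepsilon+\kappa<0$ and $\varepsilon=1,\kappa<0$ or $\varepsilon=-1,\kappa>0$: $(4H^2\varepsilon+\kappa)\,\kappa\,\mathrm{sn}_\kappa^2(\rho/2)=4H^2\varepsilon\,\mathrm{cs}_\kappa^2(ct/2)$; - for $\varepsilon=-1$, $\kappa<0$: $(4H^2\varepsilon+\kappa)\,\mathrm{sn}_\kappa^2(\rho/2)=4H^2\varepsilon\,\mathrm{sn}_\kappa^2(ct/2)$; - for $\varepsilon=-1$, $4H^2\varepsilon+\kappa=0$: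 $t^2=4\,\mathrm{sn}_\kappa^2(\rho/2)$; and there are no such surfaces for $\varepsilon=1$, $\kappa<0$, $4H^2\varepsilon+\kappa\ge0$. (iii) The surface has mean curvature $0$ and $Q=0$ if and only if $t$ is constant. -/

import Mathlib

noncomputable section

namespace RevolutionCMC

/-- The generalized sine: `sin (√κ x) / √κ`, `x`, `sinh (√(-κ) x) / √(-κ)` for `κ > 0`, `κ = 0`,
`κ < 0`. It is the length of the coordinate field `∂_θ` of polar coordinates `(ρ, θ)` of the
simply connected space form of curvature `κ`. -/
def sn (κ x : ℝ) : ℝ :=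
  if 0 < κ then Real.sin (√κ * x) / √κ
  else if κ < 0 then Real.sinh (√(-κ) * x) / √(-κ)
  else x

/-- The generalized cosine, the derivative of `sn κ`. -/
def cs (κ x : ℝ) : ℝ :=
  if 0 < κ then Real.cos (√κ * x)
  else if κ < 0 then Real.cosh (√(-κ) * x)
  else 1

theorem hasDerivAt_sn (κ x : ℝ) : HasDerivAt (sn κ) (cs κ x) x := by
  unfold sn cs
  split_ifs with h1 h2
  · have h : √κ ≠ 0 := (Real.sqrt_pos.2 h1).ne'
    have h3 : HasDerivAt (fun y : ℝ => √κ * y) (√κ) x := by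
      simpa using (hasDerivAt_id x).const_mul (√κ)
    simpa [h] using h3.sin.div_const (√κ)
  · have h : √(-κ) ≠ 0 := (Real.sqrt_pos.2 (by linarith)).ne'
    have h3 : HasDerivAt (fun y : ℝ => √(-κ) * y) (√(-κ)) x := by
      simpa using (hasDerivAt_id x).const_mul (√(-κ))
    simpa [h] using h3.sinh.div_const (√(-κ))
  · exact hasDerivAt_id x

theorem hasDerivAt_cs (κ x : ℝ) : HasDerivAt (cs κ) (-κ * sn κ x) x := by
  unfold sn cs
  split_ifs with h1 h2
  · have h : √κ ≠ 0 := (Real.sqrt_pos.2 h1).ne'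
    have h3 : HasDerivAt (fun y : ℝ => √κ * y) (√κ) x := by
      simpa using (hasDerivAt_id x).const_mul (√κ)
    refine h3.cos.congr_deriv ?_
    field_simp
    rw [Real.sq_sqrt h1.le]
    ring
  · have h : √(-κ) ≠ 0 := (Real.sqrt_pos.2 (by linarith)).ne'
    have h3 : HasDerivAt (fun y : ℝ => √(-κ) * y) (√(-κ)) x := by
      simpa using (hasDerivAt_id x).const_mul (√(-κ))
    refine h3.cosh.congr_deriv ?_
    field_simp
    rw [Real.sq_sqrt (by linarith)]
    ring
  · have : κ = 0 := le_antisymm (not_lt.1 h1) (not_lt.1 h2)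
    simpa [this] using hasDerivAt_const x (1 : ℝ)

theorem cs_sq_add (κ x : ℝ) : cs κ x ^ 2 + κ * sn κ x ^ 2 = 1 := by
  unfold sn cs
  split_ifs with h1 h2
  · have h : √κ ≠ 0 := (Real.sqrt_pos.2 h1).ne'
    rw [div_pow, Real.sq_sqrt h1.le]
    field_simp
    exact Real.cos_sq_add_sin_sq _
  · rw [div_pow, Real.sq_sqrt (by linarith : 0 ≤ -κ), Real.cosh_sq]
    have h : κ ≠ 0 := h2.ne
    field_simp
    ring
  · have : κ = 0 := le_antisymm (not_lt.1 h1) (not_lt.1 h2)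
    simp [this]

/-! ### The ambient space `M²(κ) × ℝ` inside a four-dimensional pseudo-Euclidean space -/

/-- The number `r` with `κ = sgn κ / r²`. -/
def radius (κ : ℝ) : ℝ := 1 / √|κ|

/-- The flat metric `dx₀² + dx₁² + sgn(κ) dx₂² + ε dx₃²` on `ℝ⁴ = ℝ³ × ℝ`. -/
def metric (κ ε : ℝ) (x y : Fin 4 → ℝ) : ℝ :=
  x 0 * y 0 + x 1 * y 1 + Real.sign κ * (x 2 * y 2) + ε * (x 3 * y 3)

/-- The component `p ∈ ℝ³` of a point `(p, t)` of `ℝ³ × ℝ`, as a vector of `ℝ⁴`. -/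
def horizontal (x : Fin 4 → ℝ) : Fin 4 → ℝ := ![x 0, x 1, x 2, 0]

/-- The product `M²(κ) × ℝ` for `κ ≠ 0`: here `M²(κ)` is the sphere `⟨p, p⟩ = 1 / κ` of `ℝ³` when
`κ > 0`, and the upper sheet of the hyperboloid `⟨p, p⟩ = 1 / κ` of Minkowski space when
`κ < 0`. -/
def productSpace (κ ε : ℝ) : Set (Fin 4 → ℝ) :=
  {x | metric κ ε (horizontal x) (horizontal x) = 1 / κ ∧ (κ < 0 → 0 < x 2)}

/-- The point of `M²(κ) × ℝ` with cylindrical coordinates `(ρ, θ, t)`: `(ρ, θ)` are geodesic polar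
coordinates of `M²(κ)` centered at `p₀ = (0, 0, r)`. -/
def cylindrical (κ ρ θ t : ℝ) : Fin 4 → ℝ :=
  ![sn κ ρ * Real.cos θ, sn κ ρ * Real.sin θ, radius κ * cs κ ρ, t]

theorem sign_mul_radius_sq {κ : ℝ} (hκ : κ ≠ 0) : Real.sign κ * radius κ ^ 2 = 1 / κ := by
  have h : |κ| ≠ 0 := abs_ne_zero.2 hκ
  rw [radius, div_pow, Real.sq_sqrt (abs_nonneg κ)]
  rcases lt_or_gt_of_ne hκ with h1 | h1
  · rw [Real.sign_of_neg h1, abs_of_neg h1]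
    field_simp
  · rw [Real.sign_of_pos h1, abs_of_pos h1]
    ring

theorem cylindrical_mem {κ : ℝ} (hκ : κ ≠ 0) (ε ρ θ t : ℝ) :
    cylindrical κ ρ θ t ∈ productSpace κ ε := by
  refine ⟨?_, fun h => ?_⟩
  · have h1 := sign_mul_radius_sq hκ
    have h2 := cs_sq_add κ ρ
    have h3 := Real.sin_sq_add_cos_sq θ
    simp only [metric, horizontal, cylindrical, Matrix.cons_val]
    have h4 : sn κ ρ ^ 2 + 1 / κ * cs κ ρ ^ 2 = 1 / κ := by
      field_simp
      linarith
    linear_combination sn κ ρ ^ 2 * h3 + cs κ ρ ^ 2 * h1 + h4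
  · have h0 : ¬ 0 < κ := not_lt.2 h.le
    simp only [cylindrical, cs, radius, h, h0, if_true, if_false, Matrix.cons_val]
    have := Real.sqrt_pos.2 (abs_pos.2 hκ)
    have := Real.cosh_pos (√(-κ) * ρ)
    positivity

/-- The coordinate vector field `∂_ρ`. -/
def dRho (κ ρ θ : ℝ) : Fin 4 → ℝ :=
  ![cs κ ρ * Real.cos θ, cs κ ρ * Real.sin θ, radius κ * (-κ * sn κ ρ), 0]

/-- The vertical coordinate vector field `∂_t`. -/
def dT : Fin 4 → ℝ := ![0, 0, 0, 1]

/-! ### Parametrized surfaces -/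

/-- The second derivative `D²X_p (v, w)` in `ℝ⁴` of a parametrization `X`. -/
def secondDeriv (X : ℝ × ℝ → Fin 4 → ℝ) (p v w : ℝ × ℝ) : Fin 4 → ℝ :=
  fderiv ℝ (fun q => fderiv ℝ X q w) p v

/-- The first fundamental form of `X` at `p`. -/
def firstForm (κ ε : ℝ) (X : ℝ × ℝ → Fin 4 → ℝ) (p v w : ℝ × ℝ) : ℝ :=
  metric κ ε (fderiv ℝ X p v) (fderiv ℝ X p w)

/-- The second fundamental form of `X` at `p` in the direction of the normal vector `n`:
`h(v, w) = ⟨D_v w, n⟩`. -/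
def secondForm (κ ε : ℝ) (X : ℝ × ℝ → Fin 4 → ℝ) (n : Fin 4 → ℝ) (p v w : ℝ × ℝ) : ℝ :=
  metric κ ε (secondDeriv X p v w) n

/-- `n` is a unit normal vector of the surface `X` in `M²(κ) × ℝ` at the point `X p`:
it is tangent to `M²(κ) × ℝ`, orthogonal to `X`, and `⟨n, n⟩ = ε`. -/
def IsUnitNormal (κ ε : ℝ) (X : ℝ × ℝ → Fin 4 → ℝ) (n : Fin 4 → ℝ) (p : ℝ × ℝ) : Prop :=
  metric κ ε n (horizontal (X p)) = 0 ∧ (∀ v, metric κ ε n (fderiv ℝ X p v) = 0) ∧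
    metric κ ε n n = ε

/-- The mean curvature `H = (eG - 2fF + gE) / (2(EG - F²))` at `p` of the surface `X` in
`M²(κ) × ℝ` with unit normal field `n`. -/
def meanCurvature (κ ε : ℝ) (X n : ℝ × ℝ → Fin 4 → ℝ) (p : ℝ × ℝ) : ℝ :=
  let E := firstForm κ ε X p (1, 0) (1, 0)
  let F := firstForm κ ε X p (1, 0) (0, 1)
  let G := firstForm κ ε X p (0, 1) (0, 1)
  let e := secondForm κ ε X (n p) p (1, 0) (1, 0)
  let f := secondForm κ ε X (n p) p (1, 0) (0, 1)
  let g := secondForm κ ε X (n p) p (0, 1) (0, 1)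
  (e * G - 2 * f * F + g * E) / (2 * (E * G - F ^ 2))

/-- `(a, b)` is the frame `(∂_u, ∂_v)` at `p` of some conformal coordinates of the surface. -/
def IsConformalFrame (κ ε : ℝ) (X : ℝ × ℝ → Fin 4 → ℝ) (p a b : ℝ × ℝ) : Prop :=
  firstForm κ ε X p a a = firstForm κ ε X p b b ∧ firstForm κ ε X p a b = 0 ∧
    0 < firstForm κ ε X p a a

/-- The coefficient `ψ = (h(∂_u, ∂_u) - h(∂_v, ∂_v)) / 2 - i h(∂_u, ∂_v)` at `p` of the Hopf
differential `ψ dz²`, `z = u + iv`, of the second fundamental form in the direction `n`, where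
`(a, b) = (∂_u, ∂_v)` is a conformal frame. -/
def hopfCoeff (κ ε : ℝ) (X : ℝ × ℝ → Fin 4 → ℝ) (n : Fin 4 → ℝ) (p a b : ℝ × ℝ) : ℂ :=
  (((secondForm κ ε X n p a a - secondForm κ ε X n p b b) / 2 : ℝ) : ℂ)
    - Complex.I * ((secondForm κ ε X n p a b : ℝ) : ℂ)

/-- The coefficient in a conformal frame `(a, b)` of the quadratic differential
`Q = 2H Ψ¹ - ε (sgn κ / r) Ψ²`, where `Ψ¹` and `Ψ²` are the Hopf differentials of the surface with
respect to its unit normal `n₁ = n` in `M²(κ) × ℝ` and the unit normal `n₂ = p / r` of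
`M²(κ) × ℝ` in `ℝ⁴`. -/
def qCoeff (κ ε : ℝ) (X n : ℝ × ℝ → Fin 4 → ℝ) (p a b : ℝ × ℝ) : ℂ :=
  ((2 * meanCurvature κ ε X n p : ℝ) : ℂ) * hopfCoeff κ ε X (n p) p a b
    - ((ε * (Real.sign κ / radius κ) : ℝ) : ℂ)
      * hopfCoeff κ ε X ((1 / radius κ) • horizontal (X p)) p a b

/-- `Q = 0` on the part of the surface parametrized by `D`: the coefficient of `Q` vanishes in
every conformal frame. -/
def QVanishesOn (κ ε : ℝ) (X n : ℝ × ℝ → Fin 4 → ℝ) (D : Set (ℝ × ℝ)) : Prop :=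
  ∀ p ∈ D, ∀ a b, IsConformalFrame κ ε X p a b → qCoeff κ ε X n p a b = 0

/-! ### Revolution surfaces -/

/-- `s ↦ (ρ s, 0, t s)`, `s ∈ J`, is the profile curve of a space-like revolution surface with
axis `{p₀} × ℝ`: `J` is a nonempty open interval, the curve is twice continuously differentiable
and stays in the domain of the polar coordinates (off the axis), and the metric induced on the
surface is Riemannian, that is `ρ'² + ε t'² > 0`. -/
structure IsProfile (κ ε : ℝ) (J : Set ℝ) (ρ t : ℝ → ℝ) : Prop where
  isOpen : IsOpen J
  ordConnected : J.OrdConnected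
  nonempty : J.Nonempty
  contDiffOn_rho : ContDiffOn ℝ 2 ρ J
  contDiffOn_t : ContDiffOn ℝ 2 t J
  rho_pos : ∀ s ∈ J, 0 < ρ s
  rho_lt : 0 < κ → ∀ s ∈ J, ρ s < Real.pi / √κ
  spacelike : ∀ s ∈ J, 0 < deriv ρ s ^ 2 + ε * deriv t s ^ 2

/-- The revolution surface `X(s, θ) = (ρ(s), θ, t(s))`. -/
def revolution (κ : ℝ) (ρ t : ℝ → ℝ) (p : ℝ × ℝ) : Fin 4 → ℝ :=
  cylindrical κ (ρ p.1) p.2 (t p.1)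

/-- `W = (sn_κ²(ρ) (ρ'² + ε t'²))^{1/2}`. -/
def areaDensity (κ ε : ℝ) (ρ t : ℝ → ℝ) (s : ℝ) : ℝ :=
  √(sn κ (ρ s) ^ 2 * (deriv ρ s ^ 2 + ε * deriv t s ^ 2))

/-- The unit normal field `n = W⁻¹ (sn_κ(ρ) t' ∂_ρ - ε sn_κ(ρ) ρ' ∂_t)` of a revolution
surface. -/
def revolutionNormal (κ ε : ℝ) (ρ t : ℝ → ℝ) (p : ℝ × ℝ) : Fin 4 → ℝ :=
  (areaDensity κ ε ρ t p.1)⁻¹ •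
    ((sn κ (ρ p.1) * deriv t p.1) • dRho κ (ρ p.1) p.2
      - (ε * sn κ (ρ p.1) * deriv ρ p.1) • dT)

theorem fderiv_revolution {κ : ℝ} {ρ t : ℝ → ℝ} {p : ℝ × ℝ}
    (hρ : DifferentiableAt ℝ ρ p.1) (ht : DifferentiableAt ℝ t p.1) (v : ℝ × ℝ) :
    fderiv ℝ (revolution κ ρ t) p v =
      (v.1 * deriv ρ p.1) • dRho κ (ρ p.1) p.2 + (v.1 * deriv t p.1) • dT
        + (v.2 * sn κ (ρ p.1)) • ![-Real.sin p.2, Real.cos p.2, 0, 0] := by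
  have h1 : HasFDerivAt (fun q : ℝ × ℝ => ρ q.1)
      (deriv ρ p.1 • ContinuousLinearMap.fst ℝ ℝ ℝ) p :=
    hρ.hasDerivAt.comp_hasFDerivAt p hasFDerivAt_fst
  have h2 : HasFDerivAt (fun q : ℝ × ℝ => t q.1)
      (deriv t p.1 • ContinuousLinearMap.fst ℝ ℝ ℝ) p :=
    ht.hasDerivAt.comp_hasFDerivAt p hasFDerivAt_fst
  have h3 := (hasDerivAt_sn κ (ρ p.1)).comp_hasFDerivAt p h1
  have h4 := (hasDerivAt_cs κ (ρ p.1)).comp_hasFDerivAt p h1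
  have h5 : HasFDerivAt (fun q : ℝ × ℝ => Real.cos q.2)
      (-Real.sin p.2 • ContinuousLinearMap.snd ℝ ℝ ℝ) p :=
    (Real.hasDerivAt_cos p.2).comp_hasFDerivAt p hasFDerivAt_snd
  have h6 : HasFDerivAt (fun q : ℝ × ℝ => Real.sin q.2)
      (Real.cos p.2 • ContinuousLinearMap.snd ℝ ℝ ℝ) p :=
    (Real.hasDerivAt_sin p.2).comp_hasFDerivAt p hasFDerivAt_snd
  have key := hasFDerivAt_pi.2 (Fin.forall_fin_succ.2 ⟨h3.mul h5, Fin.forall_fin_succ.2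
    ⟨h3.mul h6, Fin.forall_fin_succ.2 ⟨h4.const_mul (radius κ), Fin.forall_fin_succ.2
    ⟨h2, fun i => i.elim0⟩⟩⟩⟩ : ∀ i : Fin 4, HasFDerivAt (fun q => revolution κ ρ t q i)
      ((![_, _, _, _] : Fin 4 → (ℝ × ℝ →L[ℝ] ℝ)) i) p)
  rw [show fderiv ℝ (revolution κ ρ t) p = _ from key.fderiv]
  ext i
  fin_cases i <;> simp [dRho, dT] <;> ring

theorem revolutionNormal_isUnitNormal {κ ε : ℝ} (hκ : κ ≠ 0) (hε : ε = 1 ∨ ε = -1) {J : Set ℝ}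
    {ρ t : ℝ → ℝ} (h : IsProfile κ ε J ρ t) {p : ℝ × ℝ} (hp : p.1 ∈ J) :
    IsUnitNormal κ ε (revolution κ ρ t) (revolutionNormal κ ε ρ t p) p := by
  have hρ : DifferentiableAt ℝ ρ p.1 :=
    (h.contDiffOn_rho.contDiffAt (h.isOpen.mem_nhds hp)).differentiableAt (by norm_num)
  have ht : DifferentiableAt ℝ t p.1 :=
    (h.contDiffOn_t.contDiffAt (h.isOpen.mem_nhds hp)).differentiableAt (by norm_num)
  have hsn : 0 < sn κ (ρ p.1) := by
    have h0 := h.rho_pos _ hp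
    unfold sn
    split_ifs with h1 h2
    · have h3 := Real.sqrt_pos.2 h1
      have h4 := (lt_div_iff₀ h3).1 (h.rho_lt h1 _ hp)
      exact div_pos (Real.sin_pos_of_pos_of_lt_pi (by positivity) (by linarith)) h3
    · have h3 : 0 < √(-κ) := Real.sqrt_pos.2 (by linarith)
      exact div_pos (Real.sinh_pos_iff.2 (by positivity)) h3
    · exact h0
  have hpos : 0 < sn κ (ρ p.1) ^ 2 * (deriv ρ p.1 ^ 2 + ε * deriv t p.1 ^ 2) :=
    mul_pos (by positivity) (h.spacelike _ hp)
  have hW : 0 < areaDensity κ ε ρ t p.1 := Real.sqrt_pos.2 hpos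
  have hW2 : areaDensity κ ε ρ t p.1 ^ 2
      = sn κ (ρ p.1) ^ 2 * (deriv ρ p.1 ^ 2 + ε * deriv t p.1 ^ 2) := Real.sq_sqrt hpos.le
  have hε2 : ε ^ 2 = 1 := by rcases hε with rfl | rfl <;> norm_num
  have hr := sign_mul_radius_sq hκ
  have hrk : Real.sign κ * radius κ ^ 2 * κ = 1 := by
    rw [hr]
    field_simp
  have hc := cs_sq_add κ (ρ p.1)
  have htr := Real.sin_sq_add_cos_sq p.2
  refine ⟨?_, fun v => ?_, ?_⟩
  · simp [metric, horizontal, revolutionNormal, revolution, cylindrical, dRho, dT]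
    set W := areaDensity κ ε ρ t p.1
    linear_combination W⁻¹ * sn κ (ρ p.1) ^ 2 * deriv t p.1 * cs κ (ρ p.1) * (htr - hrk)
  · rw [fderiv_revolution hρ ht]
    simp [metric, revolutionNormal, dRho, dT]
    set W := areaDensity κ ε ρ t p.1
    linear_combination W⁻¹ * sn κ (ρ p.1) * deriv t p.1 * v.1 * deriv ρ p.1 *
      (cs κ (ρ p.1) ^ 2 * htr + κ * sn κ (ρ p.1) ^ 2 * hrk + hc - hε2)
  · simp [metric, revolutionNormal, dRho, dT]
    set W := areaDensity κ ε ρ t p.1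
    field_simp
    rw [hW2]
    linear_combination (sn κ (ρ p.1) ^ 2 * deriv t p.1 ^ 2) *
      (cs κ (ρ p.1) ^ 2 * htr + κ * sn κ (ρ p.1) ^ 2 * hrk + hc)
      + (sn κ (ρ p.1) ^ 2 * (ε * deriv ρ p.1 ^ 2 - deriv t p.1 ^ 2)) * hε2

/-- The revolution surface with profile `(ρ, t)` on `J` has constant mean curvature `H`. -/
def HasMeanCurvature (κ ε : ℝ) (J : Set ℝ) (ρ t : ℝ → ℝ) (H : ℝ) : Prop :=
  ∀ p ∈ J ×ˢ (Set.univ : Set ℝ),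
    meanCurvature κ ε (revolution κ ρ t) (revolutionNormal κ ε ρ t) p = H

/-- The quadratic differential `Q` of the revolution surface with profile `(ρ, t)` on `J` is
identically zero. -/
def QVanishes (κ ε : ℝ) (J : Set ℝ) (ρ t : ℝ → ℝ) : Prop :=
  QVanishesOn κ ε (revolution κ ρ t) (revolutionNormal κ ε ρ t) (J ×ˢ (Set.univ : Set ℝ))

/-- The first integral `t' sn_κ²(ρ) / W = I - 2H ∫ sn_κ(ρ) dρ` of the mean curvature equation
holds with constant `I`, where `∫ sn_κ(ρ) dρ` is the antiderivative `-cs_κ(ρ) / κ`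
(see `hasDerivAt_cs`). -/
def HasFirstIntegral (κ ε : ℝ) (J : Set ℝ) (ρ t : ℝ → ℝ) (H I : ℝ) : Prop :=
  ∀ s ∈ J, deriv t s * sn κ (ρ s) ^ 2 / areaDensity κ ε ρ t s
    = I - 2 * H * (-cs κ (ρ s) / κ)

/-- The equation of the profile curves with `I = -2H/κ`, according to the signs of `ε` and of
`4H²ε + κ`. -/
def ProfileEqMinus (κ ε H ρ t : ℝ) : Prop :=
  (ε = 1 ∧ 0 < 4 * H ^ 2 * ε + κ ∧
    (4 * H ^ 2 * ε + κ) * sn κ (ρ / 2) ^ 2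
      + 4 * H ^ 2 * ε * sn (-κ) (√(ε + κ / (4 * H ^ 2)) * t / 2) ^ 2 = 1) ∨
  (ε = -1 ∧ 0 < 4 * H ^ 2 * ε + κ ∧
    4 * H ^ 2 * ε * κ * sn (-κ) (√(ε + κ / (4 * H ^ 2)) * t / 2) ^ 2
      = -(4 * H ^ 2 * ε + κ) * cs κ (ρ / 2) ^ 2) ∨
  (ε = -1 ∧ 4 * H ^ 2 * ε + κ < 0 ∧
    (4 * H ^ 2 * ε + κ) * sn κ (ρ / 2) ^ 2
      - 4 * H ^ 2 * ε * sn κ (√(-(ε + κ / (4 * H ^ 2))) * t / 2) ^ 2 = 1) ∨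
  (ε = 1 ∧ 4 * H ^ 2 * ε + κ < 0 ∧
    4 * H ^ 2 * ε * κ * sn κ (√(-(ε + κ / (4 * H ^ 2))) * t / 2) ^ 2
      = (4 * H ^ 2 * ε + κ) * cs κ (ρ / 2) ^ 2) ∨
  (4 * H ^ 2 * ε + κ = 0 ∧ t ^ 2 = Real.sign κ * (4 / κ) * cs κ (ρ / 2) ^ 2)

/-- The equation of the profile curves with `I = 2H/κ`, according to the signs of `ε`, `κ` and
`4H²ε + κ`. There are none for `ε = 1`, `κ < 0`, `4H²ε + κ ≥ 0`. -/
def ProfileEqPlus (κ ε H ρ t : ℝ) : Prop :=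
  (ε = 1 ∧ 0 < κ ∧ 0 < 4 * H ^ 2 * ε + κ ∧
    (4 * H ^ 2 * ε + κ) * κ * sn κ (ρ / 2) ^ 2
      = 4 * H ^ 2 * ε * cs (-κ) (√(ε + κ / (4 * H ^ 2)) * t / 2) ^ 2) ∨
  (ε = -1 ∧ 0 < κ ∧ 0 < 4 * H ^ 2 * ε + κ ∧
    (4 * H ^ 2 * ε + κ) * sn κ (ρ / 2) ^ 2
      = -(4 * H ^ 2 * ε) * sn (-κ) (√(ε + κ / (4 * H ^ 2)) * t / 2) ^ 2) ∨
  (((ε = 1 ∧ κ < 0) ∨ (ε = -1 ∧ 0 < κ)) ∧ 4 * H ^ 2 * ε + κ < 0 ∧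
    (4 * H ^ 2 * ε + κ) * κ * sn κ (ρ / 2) ^ 2
      = 4 * H ^ 2 * ε * cs κ (√(-(ε + κ / (4 * H ^ 2))) * t / 2) ^ 2) ∨
  (ε = -1 ∧ κ < 0 ∧ 4 * H ^ 2 * ε + κ < 0 ∧
    (4 * H ^ 2 * ε + κ) * sn κ (ρ / 2) ^ 2
      = 4 * H ^ 2 * ε * sn κ (√(-(ε + κ / (4 * H ^ 2))) * t / 2) ^ 2) ∨
  (ε = -1 ∧ 4 * H ^ 2 * ε + κ = 0 ∧ t ^ 2 = 4 * sn κ (ρ / 2) ^ 2)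

end RevolutionCMC

end

open RevolutionCMC

/-!
Everything is expressed through the profile curve. Let `v` be its speed `√(ρ'² + ε t'²)`. In the
coordinates `(s, θ)` the metric and both second fundamental forms are diagonal, so that the mean
curvature is `((ρ'' t' - ρ' t'') / v³ - cs_κ(ρ) t' / (sn_κ(ρ) v)) / 2` (`meanCurvature_revolution`)
and `Q`, the trace-free part of a quadratic form, vanishes when that form is a multiple of the
metric (`qVanishes_iff`).

The derivative of `t' sn_κ(ρ) / v` is `-ρ' sn_κ(ρ)` times twice the mean curvature. Constant mean
curvature `H` thus gives the first integral (`exists_hasFirstIntegral`), and inserting it in the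
equation `Q = 0` leaves `κ² I² = 4 H²` at every point (`qVanishes_iff_firstIntegral`). For `H = 0`
this says `t' = 0`.

For `H ≠ 0` and `I = ∓2H / κ`, half-angle formulas turn the first integral into
`t' cs_κ(ρ/2) = -2H sn_κ(ρ/2) v`, respectively `κ t' sn_κ(ρ/2) = 2H cs_κ(ρ/2) v`. In particular
`t'` has no zeros, and squaring shows that `y = cs_κ(ρ/2)`, respectively `y = sn_κ(ρ/2)`, as a
function of `t`, has constant energy `μ y² - (dy/dt)² = δ` with `μ = κ (4 H² ε + κ) / (16 H²)` and
`δ = κ ε / 4`, respectively `δ = ε / 4`. The first order equation does not suffice: it also has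
constant solutions, cylinders whose mean curvature is not `±H`. The mean curvature equation
provides the second order equation `d²y/dt² = μ y`. Conversely these two equations for `y` give
back the first integral up to the sign of `H`, which is constant since `J` is connected, and the
mean curvature (`solvesLinearODE_cs_half`, `exists_hasMeanCurvature_of_cs_half` and their
counterparts for `sn`).

Finally, a solution of the linear equation with `δ ≠ 0` has, up to a translation of `t`, the form
`μ y² = δ cs_{-μ}(t)²` if `μ δ > 0` and `y² = -δ sn_{-μ}(t)²` if `μ ≥ 0 > δ`, and there is none if
`μ ≤ 0 < δ` (`exists_normalForm_iff`). The equations in the statement are these normal forms,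
distinguished by the signs of `ε`, `κ` and `4 H² ε + κ` (`profileEqMinus_iff`,
`profileEqPlus_iff`).
-/

namespace RevolutionCMC

/-! ### Generalized trigonometric functions -/

theorem sn_add (κ x y : ℝ) : sn κ (x + y) = sn κ x * cs κ y + cs κ x * sn κ y := by
  unfold sn cs
  split_ifs with h1 h2
  · rw [mul_add, Real.sin_add]; ring
  · rw [mul_add, Real.sinh_add]; ring
  · ring

theorem cs_add (κ x y : ℝ) : cs κ (x + y) = cs κ x * cs κ y - κ * (sn κ x * sn κ y) := by
  unfold sn cs
  split_ifs with h1 h2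
  · have h : √κ ≠ 0 := (Real.sqrt_pos.2 h1).ne'
    rw [mul_add, Real.cos_add]
    field_simp
    rw [Real.sq_sqrt h1.le]
    ring
  · have h : √(-κ) ≠ 0 := (Real.sqrt_pos.2 (by linarith)).ne'
    rw [mul_add, Real.cosh_add]
    field_simp
    rw [Real.sq_sqrt (by linarith)]
    ring
  · have : κ = 0 := le_antisymm (not_lt.1 h1) (not_lt.1 h2)
    simp [this]

theorem sn_neg (κ x : ℝ) : sn κ (-x) = -sn κ x := by
  unfold sn
  split_ifs <;> simp [neg_div]

theorem cs_neg (κ x : ℝ) : cs κ (-x) = cs κ x := by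
  unfold cs
  split_ifs <;> simp

theorem sn_sub (κ x y : ℝ) : sn κ (x - y) = sn κ x * cs κ y - cs κ x * sn κ y := by
  rw [sub_eq_add_neg, sn_add, sn_neg, cs_neg]
  ring

theorem cs_sub (κ x y : ℝ) : cs κ (x - y) = cs κ x * cs κ y + κ * (sn κ x * sn κ y) := by
  rw [sub_eq_add_neg, cs_add, sn_neg, cs_neg]
  ring

theorem sn_eq_half (κ x : ℝ) : sn κ x = 2 * sn κ (x / 2) * cs κ (x / 2) := by
  conv_lhs => rw [← add_halves x, sn_add]
  ring

theorem cs_eq_half (κ x : ℝ) : cs κ x = 1 - 2 * κ * sn κ (x / 2) ^ 2 := by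
  conv_lhs => rw [← add_halves x, cs_add]
  linear_combination cs_sq_add κ (x / 2)

theorem sn_mul {c : ℝ} (hc : 0 < c) (κ x : ℝ) : sn κ (c * x) = c * sn (κ * c ^ 2) x := by
  have hc2 : 0 < c ^ 2 := by positivity
  unfold sn
  have hneg : κ * c ^ 2 < 0 ↔ κ < 0 := by
    rw [← neg_pos, ← neg_mul, mul_pos_iff_of_pos_right hc2, neg_pos]
  simp only [mul_pos_iff_of_pos_right hc2, hneg]
  split_ifs with h1 h2
  · have h : √κ ≠ 0 := (Real.sqrt_pos.2 h1).ne'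
    rw [Real.sqrt_mul h1.le, Real.sqrt_sq hc.le, mul_assoc]
    field_simp
  · have h : √(-κ) ≠ 0 := (Real.sqrt_pos.2 (by linarith)).ne'
    rw [← neg_mul, Real.sqrt_mul (by linarith), Real.sqrt_sq hc.le, mul_assoc]
    field_simp
  · rfl

theorem cs_mul {c : ℝ} (hc : 0 < c) (κ x : ℝ) : cs κ (c * x) = cs (κ * c ^ 2) x := by
  have hc2 : 0 < c ^ 2 := by positivity
  unfold cs
  have hneg : κ * c ^ 2 < 0 ↔ κ < 0 := by
    rw [← neg_pos, ← neg_mul, mul_pos_iff_of_pos_right hc2, neg_pos]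
  simp only [mul_pos_iff_of_pos_right hc2, hneg]
  split_ifs with h1 h2
  · rw [Real.sqrt_mul h1.le, Real.sqrt_sq hc.le, mul_assoc]
  · rw [← neg_mul, Real.sqrt_mul (by linarith), Real.sqrt_sq hc.le, mul_assoc]
  · rfl

theorem sn_pos {κ x : ℝ} (hx : 0 < x) (hκ : 0 < κ → x < Real.pi / √κ) : 0 < sn κ x := by
  unfold sn
  split_ifs with h1 h2
  · have h3 := Real.sqrt_pos.2 h1
    have h4 := (lt_div_iff₀ h3).1 (hκ h1)
    exact div_pos (Real.sin_pos_of_pos_of_lt_pi (by positivity) (by linarith)) h3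
  · have h3 : 0 < √(-κ) := Real.sqrt_pos.2 (by linarith)
    exact div_pos (Real.sinh_pos_iff.2 (by positivity)) h3
  · exact hx

/-- The curve `(cs κ, sn κ)` runs through the whole conic `p ^ 2 + κ * q ^ 2 = 1` if that is
connected, and through its branch `0 < p` otherwise. -/
theorem exists_cs_eq_sn_eq {κ p q : ℝ} (h : p ^ 2 + κ * q ^ 2 = 1) (hp : κ ≤ 0 → 0 < p) :
    ∃ x, cs κ x = p ∧ sn κ x = q := by
  unfold cs sn
  split_ifs with h1 h2
  · have hs : √κ ≠ 0 := (Real.sqrt_pos.2 h1).ne'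
    have hn : ‖(⟨p, √κ * q⟩ : ℂ)‖ = 1 := by
      rw [Complex.norm_def, Complex.normSq_mk, Real.sqrt_eq_one]
      linear_combination h + q ^ 2 * Real.sq_sqrt h1.le
    have hz : (⟨p, √κ * q⟩ : ℂ) ≠ 0 := by
      rw [← norm_pos_iff, hn]
      exact one_pos
    refine ⟨Complex.arg ⟨p, √κ * q⟩ / √κ, ?_, ?_⟩
    · rw [mul_div_cancel₀ _ hs, Complex.cos_arg hz, hn, div_one]
    · rw [mul_div_cancel₀ _ hs, Complex.sin_arg, hn]
      field_simp
  · have hs : √(-κ) ≠ 0 := (Real.sqrt_pos.2 (by linarith)).ne'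
    refine ⟨Real.arsinh (√(-κ) * q) / √(-κ), ?_, ?_⟩
    · rw [mul_div_cancel₀ _ hs, Real.cosh_arsinh, ← Real.sqrt_sq (hp h2.le).le]
      congr 1
      rw [mul_pow, Real.sq_sqrt (by linarith)]
      linarith
    · rw [mul_div_cancel₀ _ hs, Real.sinh_arsinh]
      field_simp
  · have h0 : κ = 0 := le_antisymm (not_lt.1 h1) (not_lt.1 h2)
    subst h0
    refine ⟨q, ?_, rfl⟩
    have := hp le_rfl
    nlinarith

/-! ### Solutions of `y'' = λ y` along a curve -/

/-- With `τ ↦ y` a solution of `y'' = μ y` whose energy `μ y² - y'²` is `δ ≠ 0`, the equation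
relating `y` and `τ` once the origin of `τ` is moved to a critical point or to a zero of `y`. -/
def NormalForm (μ δ y τ : ℝ) : Prop :=
  (0 < μ * δ ∧ μ * y ^ 2 = δ * cs (-μ) τ ^ 2) ∨
  (0 ≤ μ ∧ δ < 0 ∧ y ^ 2 = -δ * sn (-μ) τ ^ 2)

/-- Along the curve `s ↦ (t, y)`, the function `w = dy/dt` satisfies `dw/dt = μ y` and the energy
`μ y² - w²` is `δ`. Writing the equations in the parameter `s` makes sense even where
`t' = 0`. -/
def SolvesLinearODE (J : Set ℝ) (t : ℝ → ℝ) (μ δ : ℝ) (y : ℝ → ℝ) : Prop :=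
  ∃ w : ℝ → ℝ, ∀ s ∈ J, HasDerivAt y (w s * deriv t s) s ∧
    HasDerivAt w (μ * y s * deriv t s) s ∧ μ * y s ^ 2 - w s ^ 2 = δ

/-- The combination with coefficients `a`, `b` is a translate of a multiple of `cs (-μ)` or of
`sn (-μ)`, according to the sign of its energy. -/
theorem exists_normalForm {μ δ a b : ℝ} (hδ : δ ≠ 0) (h : μ * a ^ 2 - b ^ 2 = δ) :
    ∃ t₀, ∀ τ, NormalForm μ δ (a * cs (-μ) τ + b * sn (-μ) τ) (τ - t₀) := by
  by_cases hμδ : 0 < μ * δ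
  · have hμ : μ ≠ 0 := fun h => by simp [h] at hμδ
    have hA2 : 0 < δ / μ := by
      rw [← mul_div_mul_left δ μ hμ]
      exact div_pos hμδ (mul_self_pos.2 hμ)
    have ha : μ < 0 ∨ a ≠ 0 := by
      rcases lt_or_ge μ 0 with h1 | h1
      · exact Or.inl h1
      · refine Or.inr fun h2 => ?_
        subst h2
        have : 0 < δ := pos_of_mul_pos_right hμδ h1
        nlinarith
    -- the amplitude has the sign of `a`, so that `(a / A, ...)` is on the branch through `(1, 0)`
    obtain ⟨A, hA, hAa⟩ : ∃ A : ℝ, A ^ 2 = δ / μ ∧ (0 < μ → 0 < a / A) := by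
      rcases lt_or_ge 0 a with h1 | h1
      · exact ⟨√(δ / μ), Real.sq_sqrt hA2.le, fun _ => div_pos h1 (Real.sqrt_pos.2 hA2)⟩
      · refine ⟨-√(δ / μ), by rw [neg_sq, Real.sq_sqrt hA2.le], fun h2 => ?_⟩
        have h3 : a ≠ 0 := ha.resolve_left h2.le.not_gt
        exact div_pos_of_neg_of_neg (lt_of_le_of_ne h1 h3)
          (neg_lt_zero.2 (Real.sqrt_pos.2 hA2))
    have hA0 : A ≠ 0 := fun h => by simp [h] at hA; grind
    have hA' : A ^ 2 * μ = δ := by rw [hA]; field_simp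
    obtain ⟨t₀, h1, h2⟩ := exists_cs_eq_sn_eq (κ := -μ) (p := a / A) (q := -b / (A * μ))
      (by field_simp; rw [hA']; linarith) (fun h => hAa (lt_of_le_of_ne (by linarith) hμ.symm))
    refine ⟨t₀, fun τ => Or.inl ⟨hμδ, ?_⟩⟩
    rw [cs_sub, h1, h2, ← hA']
    field_simp
  · have hμδ' : μ * δ ≤ 0 := not_lt.1 hμδ
    have hμ : 0 ≤ μ := by
      by_contra! h1
      have : 0 ≤ δ := by nlinarith
      have h2 : 0 < δ := lt_of_le_of_ne this hδ.symm
      nlinarith [sq_nonneg a, sq_nonneg b]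
    have hδ' : δ < 0 := by
      by_contra! h1
      have h2 : 0 < δ := lt_of_le_of_ne h1 hδ.symm
      have h3 : μ = 0 := by nlinarith
      subst h3
      nlinarith [sq_nonneg b]
    have hb : b ≠ 0 := fun h1 => by subst h1; nlinarith [sq_nonneg a]
    have hr : 0 < √(-δ) := Real.sqrt_pos.2 (by linarith)
    -- here it is `b / B` that has to be positive
    obtain ⟨B, hB, hBb⟩ : ∃ B : ℝ, B ^ 2 = -δ ∧ 0 < b / B := by
      rcases lt_or_gt_of_ne hb with h1 | h1
      · exact ⟨-√(-δ), by rw [neg_sq, Real.sq_sqrt (by linarith)],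
          div_pos_of_neg_of_neg h1 (neg_lt_zero.2 hr)⟩
      · exact ⟨√(-δ), Real.sq_sqrt (by linarith), div_pos h1 hr⟩
    have hB0 : B ≠ 0 := fun h => by simp [h] at hBb
    obtain ⟨t₀, h1, h2⟩ := exists_cs_eq_sn_eq (κ := -μ) (p := b / B) (q := -a / B)
      (by field_simp; linarith) (fun _ => hBb)
    refine ⟨t₀, fun τ => Or.inr ⟨hμ, hδ', ?_⟩⟩
    rw [sn_sub, h1, h2, ← hB]
    field_simp
    ring

/-- The solutions of `y'' = μ y` along a connected curve are the combinations of `cs (-μ)` and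
`sn (-μ)`. -/
theorem eq_cs_add_sn {J : Set ℝ} (hJo : IsOpen J) (hJ : J.OrdConnected) (hne : J.Nonempty)
    {t y w : ℝ → ℝ} {μ : ℝ} (ht : ∀ s ∈ J, DifferentiableAt ℝ t s)
    (hy : ∀ s ∈ J, HasDerivAt y (w s * deriv t s) s)
    (hw : ∀ s ∈ J, HasDerivAt w (μ * y s * deriv t s) s) :
    ∃ a b : ℝ, ∀ s ∈ J, y s = a * cs (-μ) (t s) + b * sn (-μ) (t s) ∧
      w s = μ * a * sn (-μ) (t s) + b * cs (-μ) (t s) := by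
  obtain ⟨s₀, hs₀⟩ := hne
  have hc : ∀ s ∈ J, HasDerivAt (fun s => cs (-μ) (t s)) (μ * sn (-μ) (t s) * deriv t s) s :=
    fun s hs => ((hasDerivAt_cs (-μ) (t s)).comp s (ht s hs).hasDerivAt).congr_deriv (by ring)
  have hsn : ∀ s ∈ J, HasDerivAt (fun s => sn (-μ) (t s)) (cs (-μ) (t s) * deriv t s) s :=
    fun s hs => (hasDerivAt_sn (-μ) (t s)).comp s (ht s hs).hasDerivAt
  -- variation of constants: the coefficients of `y` do not depend on `s`
  have h1 : ∀ s ∈ J, HasDerivAt (fun s => y s * cs (-μ) (t s) - w s * sn (-μ) (t s)) 0 s :=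
    fun s hs => (((hy s hs).mul (hc s hs)).sub ((hw s hs).mul (hsn s hs))).congr_deriv
      (by ring)
  have h2 : ∀ s ∈ J, HasDerivAt (fun s => w s * cs (-μ) (t s) - μ * y s * sn (-μ) (t s)) 0 s :=
    fun s hs => (((hw s hs).mul (hc s hs)).sub (((hy s hs).const_mul μ).mul
      (hsn s hs))).congr_deriv (by ring)
  have hconst : ∀ f : ℝ → ℝ, (∀ s ∈ J, HasDerivAt f 0 s) → ∀ s ∈ J, f s = f s₀ :=
    fun f hf s hs => hJo.is_const_of_deriv_eq_zero hJ.isPreconnected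
      (fun x hx => (hf x hx).differentiableAt.differentiableWithinAt)
      (fun x hx => (hf x hx).deriv) hs hs₀
  refine ⟨y s₀ * cs (-μ) (t s₀) - w s₀ * sn (-μ) (t s₀),
    w s₀ * cs (-μ) (t s₀) - μ * y s₀ * sn (-μ) (t s₀), fun s hs => ⟨?_, ?_⟩⟩
  · rw [← hconst _ h1 s hs, ← hconst _ h2 s hs]
    linear_combination -y s * cs_sq_add (-μ) (t s)
  · rw [← hconst _ h1 s hs, ← hconst _ h2 s hs]
    linear_combination -w s * cs_sq_add (-μ) (t s)

/-- If `y ^ 2 = p` without zeros, `q` is half the derivative of `p` with respect to `t`, and `p`,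
`q` satisfy the equations that `y ^ 2` and `y * w` satisfy for a solution `y` with derivative `w`, then
`y` is such a solution. -/
theorem SolvesLinearODE.of_sq {J : Set ℝ} (hJo : IsOpen J) {t y p q : ℝ → ℝ} {μ δ : ℝ}
    (hyd : ∀ s ∈ J, DifferentiableAt ℝ y s) (hy : ∀ s ∈ J, y s ≠ 0)
    (hyp : ∀ s ∈ J, y s ^ 2 = p s) (hp : ∀ s ∈ J, HasDerivAt p (2 * q s * deriv t s) s)
    (hq : ∀ s ∈ J, HasDerivAt q ((2 * μ * p s - δ) * deriv t s) s)
    (hpq : ∀ s ∈ J, q s ^ 2 = p s * (μ * p s - δ)) : SolvesLinearODE J t μ δ y := by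
  have hyy : ∀ s ∈ J, HasDerivAt y (q s / y s * deriv t s) s := fun s hs => by
    have h := ((hyd s hs).hasDerivAt.pow 2).unique ((hp s hs).congr_of_eventuallyEq
      (Filter.eventuallyEq_of_mem (hJo.mem_nhds hs) hyp))
    refine (hyd s hs).hasDerivAt.congr_deriv ?_
    have := hy s hs
    field_simp
    norm_num at h
    linear_combination h / 2
  refine ⟨fun s => q s / y s, fun s hs => ⟨hyy s hs,
    ((hq s hs).div (hyy s hs) (hy s hs)).congr_deriv ?_, ?_⟩⟩
  · have := hy s hs
    have h1 := hpq s hs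
    rw [← hyp s hs] at h1 ⊢
    field_simp
    linear_combination -deriv t s * h1
  · have := hy s hs
    have h1 := hpq s hs
    rw [← hyp s hs] at h1
    field_simp
    linear_combination -h1

/-- Along a curve, the solutions of energy `δ ≠ 0` are given by the normal forms up to a
translation of `t`. -/
theorem exists_normalForm_iff {J : Set ℝ} (hJo : IsOpen J) (hJ : J.OrdConnected)
    (hne : J.Nonempty) {t y : ℝ → ℝ} {μ δ : ℝ} (hδ : δ ≠ 0)
    (ht : ∀ s ∈ J, DifferentiableAt ℝ t s) (hyd : ∀ s ∈ J, DifferentiableAt ℝ y s)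
    (hy : ∀ s ∈ J, y s ≠ 0) :
    (∃ t₀, ∀ s ∈ J, NormalForm μ δ (y s) (t s - t₀)) ↔ SolvesLinearODE J t μ δ y := by
  constructor
  · rintro ⟨t₀, h⟩
    have hc : ∀ s ∈ J, HasDerivAt (fun s => cs (-μ) (t s - t₀))
        (μ * sn (-μ) (t s - t₀) * deriv t s) s :=
      fun s hs => ((hasDerivAt_cs (-μ) (t s - t₀)).comp (h := fun s => t s - t₀) s
        ((ht s hs).hasDerivAt.sub_const t₀)).congr_deriv (by ring)
    have hsn : ∀ s ∈ J, HasDerivAt (fun s => sn (-μ) (t s - t₀))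
        (cs (-μ) (t s - t₀) * deriv t s) s :=
      fun s hs => (hasDerivAt_sn (-μ) (t s - t₀)).comp (h := fun s => t s - t₀) s
        ((ht s hs).hasDerivAt.sub_const t₀)
    have hconic := fun s => cs_sq_add (-μ) (t s - t₀)
    by_cases hμδ : 0 < μ * δ
    · have hμ : μ ≠ 0 := fun h => by simp [h] at hμδ
      refine SolvesLinearODE.of_sq (p := fun s => δ / μ * cs (-μ) (t s - t₀) ^ 2)
        (q := fun s => δ * (cs (-μ) (t s - t₀) * sn (-μ) (t s - t₀))) hJo hyd hy
        (fun s hs => ?_) (fun s hs => (((hc s hs).pow 2).const_mul (δ / μ)).congr_deriv ?_)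
        (fun s hs => (((hc s hs).mul (hsn s hs)).const_mul δ).congr_deriv ?_) (fun s hs => ?_)
      · rcases h s hs with ⟨_, h1⟩ | ⟨h2, h3, _⟩
        · field_simp
          linear_combination h1
        · nlinarith
      · norm_num
        field_simp
      · field_simp
        linear_combination -deriv t s * hconic s
      · field_simp
        linear_combination -cs (-μ) (t s - t₀) ^ 2 * hconic s
    · have h1 : ∀ s ∈ J, y s ^ 2 = -δ * sn (-μ) (t s - t₀) ^ 2 := fun s hs =>
        ((h s hs).resolve_left fun h => hμδ h.1).2.2
      refine SolvesLinearODE.of_sq (p := fun s => -δ * sn (-μ) (t s - t₀) ^ 2)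
        (q := fun s => -δ * (cs (-μ) (t s - t₀) * sn (-μ) (t s - t₀))) hJo hyd hy h1
        (fun s hs => (((hsn s hs).pow 2).const_mul (-δ)).congr_deriv ?_)
        (fun s hs => (((hc s hs).mul (hsn s hs)).const_mul (-δ)).congr_deriv ?_)
        (fun s hs => ?_)
      · norm_num
        ring
      · linear_combination -δ * deriv t s * hconic s
      · linear_combination δ ^ 2 * sn (-μ) (t s - t₀) ^ 2 * hconic s
  · rintro ⟨w, h⟩
    obtain ⟨a, b, hab⟩ := eq_cs_add_sn hJo hJ hne ht (fun s hs => (h s hs).1)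
      (fun s hs => (h s hs).2.1)
    obtain ⟨s₀, hs₀⟩ := hne
    have hδab : μ * a ^ 2 - b ^ 2 = δ := by
      have h1 := (h s₀ hs₀).2.2
      rw [(hab s₀ hs₀).1, (hab s₀ hs₀).2] at h1
      linear_combination h1 - (μ * a ^ 2 - b ^ 2) * cs_sq_add (-μ) (t s₀)
    obtain ⟨t₀, ht₀⟩ := exists_normalForm hδ hδab
    refine ⟨t₀, fun s hs => ?_⟩
    rw [(hab s hs).1]
    exact ht₀ (t s)

/-! ### Curvature of revolution surfaces -/

theorem IsProfile.differentiableAt_rho {κ ε : ℝ} {J : Set ℝ} {ρ t : ℝ → ℝ}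
    (h : IsProfile κ ε J ρ t) {s : ℝ} (hs : s ∈ J) : DifferentiableAt ℝ ρ s :=
  (h.contDiffOn_rho.contDiffAt (h.isOpen.mem_nhds hs)).differentiableAt (by norm_num)

theorem IsProfile.differentiableAt_t {κ ε : ℝ} {J : Set ℝ} {ρ t : ℝ → ℝ}
    (h : IsProfile κ ε J ρ t) {s : ℝ} (hs : s ∈ J) : DifferentiableAt ℝ t s :=
  (h.contDiffOn_t.contDiffAt (h.isOpen.mem_nhds hs)).differentiableAt (by norm_num)

theorem differentiableAt_deriv_of_contDiffOn {f : ℝ → ℝ} {J : Set ℝ} (hJ : IsOpen J)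
    (hf : ContDiffOn ℝ 2 f J) {s : ℝ} (hs : s ∈ J) : DifferentiableAt ℝ (deriv f) s := by
  have h : ContDiffOn ℝ 1 (deriv f) J := hf.deriv_of_isOpen hJ (by norm_num)
  exact (h.contDiffAt (hJ.mem_nhds hs)).differentiableAt (by norm_num)

theorem IsProfile.hasDerivAt_deriv_rho {κ ε : ℝ} {J : Set ℝ} {ρ t : ℝ → ℝ}
    (h : IsProfile κ ε J ρ t) {s : ℝ} (hs : s ∈ J) :
    HasDerivAt (deriv ρ) (deriv (deriv ρ) s) s :=
  (differentiableAt_deriv_of_contDiffOn h.isOpen h.contDiffOn_rho hs).hasDerivAt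

theorem IsProfile.hasDerivAt_deriv_t {κ ε : ℝ} {J : Set ℝ} {ρ t : ℝ → ℝ}
    (h : IsProfile κ ε J ρ t) {s : ℝ} (hs : s ∈ J) :
    HasDerivAt (deriv t) (deriv (deriv t) s) s :=
  (differentiableAt_deriv_of_contDiffOn h.isOpen h.contDiffOn_t hs).hasDerivAt

theorem IsProfile.sn_rho_pos {κ ε : ℝ} {J : Set ℝ} {ρ t : ℝ → ℝ}
    (h : IsProfile κ ε J ρ t) {s : ℝ} (hs : s ∈ J) : 0 < sn κ (ρ s) :=
  sn_pos (h.rho_pos s hs) fun hκ => h.rho_lt hκ s hs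

/-- The length of the velocity of the profile curve. -/
noncomputable def profileSpeed (ε : ℝ) (ρ t : ℝ → ℝ) (s : ℝ) : ℝ :=
  √(deriv ρ s ^ 2 + ε * deriv t s ^ 2)

theorem IsProfile.profileSpeed_pos {κ ε : ℝ} {J : Set ℝ} {ρ t : ℝ → ℝ}
    (h : IsProfile κ ε J ρ t) {s : ℝ} (hs : s ∈ J) : 0 < profileSpeed ε ρ t s :=
  Real.sqrt_pos.2 (h.spacelike s hs)

theorem IsProfile.profileSpeed_sq {κ ε : ℝ} {J : Set ℝ} {ρ t : ℝ → ℝ}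
    (h : IsProfile κ ε J ρ t) {s : ℝ} (hs : s ∈ J) :
    profileSpeed ε ρ t s ^ 2 = deriv ρ s ^ 2 + ε * deriv t s ^ 2 :=
  Real.sq_sqrt (h.spacelike s hs).le

theorem IsProfile.areaDensity_eq {κ ε : ℝ} {J : Set ℝ} {ρ t : ℝ → ℝ}
    (h : IsProfile κ ε J ρ t) {s : ℝ} (hs : s ∈ J) :
    areaDensity κ ε ρ t s = sn κ (ρ s) * profileSpeed ε ρ t s := by
  rw [areaDensity, Real.sqrt_mul (sq_nonneg _), Real.sqrt_sq (h.sn_rho_pos hs).le, profileSpeed]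

theorem secondDeriv_revolution {κ ε : ℝ} {J : Set ℝ} {ρ t : ℝ → ℝ}
    (h : IsProfile κ ε J ρ t) {p : ℝ × ℝ} (hp : p.1 ∈ J) (a b : ℝ × ℝ) :
    secondDeriv (revolution κ ρ t) p a b =
      (a.1 * b.1 * deriv (deriv ρ) p.1) • dRho κ (ρ p.1) p.2
      + (a.1 * b.1 * deriv (deriv t) p.1) • dT
      - (a.1 * b.1 * deriv ρ p.1 ^ 2 * κ) • horizontal (revolution κ ρ t p)
      + ((a.1 * b.2 + a.2 * b.1) * (deriv ρ p.1 * cs κ (ρ p.1))) •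
        ![-Real.sin p.2, Real.cos p.2, 0, 0]
      - (a.2 * b.2 * sn κ (ρ p.1)) • ![Real.cos p.2, Real.sin p.2, 0, 0] := by
  have h1 : HasFDerivAt (fun q : ℝ × ℝ => ρ q.1)
      (deriv ρ p.1 • ContinuousLinearMap.fst ℝ ℝ ℝ) p :=
    (h.differentiableAt_rho hp).hasDerivAt.comp_hasFDerivAt p hasFDerivAt_fst
  have h1' : HasFDerivAt (fun q : ℝ × ℝ => deriv ρ q.1)
      (deriv (deriv ρ) p.1 • ContinuousLinearMap.fst ℝ ℝ ℝ) p :=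
    (h.hasDerivAt_deriv_rho hp).comp_hasFDerivAt p hasFDerivAt_fst
  have h2' : HasFDerivAt (fun q : ℝ × ℝ => deriv t q.1)
      (deriv (deriv t) p.1 • ContinuousLinearMap.fst ℝ ℝ ℝ) p :=
    (h.hasDerivAt_deriv_t hp).comp_hasFDerivAt p hasFDerivAt_fst
  have h3 := (hasDerivAt_sn κ (ρ p.1)).comp_hasFDerivAt p h1
  have h4 := (hasDerivAt_cs κ (ρ p.1)).comp_hasFDerivAt p h1
  have h5 : HasFDerivAt (fun q : ℝ × ℝ => Real.cos q.2)
      (-Real.sin p.2 • ContinuousLinearMap.snd ℝ ℝ ℝ) p :=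
    (Real.hasDerivAt_cos p.2).comp_hasFDerivAt p hasFDerivAt_snd
  have h6 : HasFDerivAt (fun q : ℝ × ℝ => Real.sin q.2)
      (Real.cos p.2 • ContinuousLinearMap.snd ℝ ℝ ℝ) p :=
    (Real.hasDerivAt_sin p.2).comp_hasFDerivAt p hasFDerivAt_snd
  have k0 := ((h1'.const_mul b.1).mul (h4.mul h5)).sub ((h3.const_mul b.2).mul h6)
  have k1 := ((h1'.const_mul b.1).mul (h4.mul h6)).add ((h3.const_mul b.2).mul h5)
  have k2 := (h1'.const_mul b.1).mul ((h3.const_mul (-κ)).const_mul (radius κ))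
  have k3 := h2'.const_mul b.1
  have key := hasFDerivAt_pi.2 (Fin.forall_fin_succ.2 ⟨k0, Fin.forall_fin_succ.2
    ⟨k1, Fin.forall_fin_succ.2 ⟨k2, Fin.forall_fin_succ.2
    ⟨k3, fun i => i.elim0⟩⟩⟩⟩ : ∀ i : Fin 4, HasFDerivAt
      (fun q : ℝ × ℝ => (![b.1 * deriv ρ q.1 * (cs κ (ρ q.1) * Real.cos q.2)
          - b.2 * sn κ (ρ q.1) * Real.sin q.2,
        b.1 * deriv ρ q.1 * (cs κ (ρ q.1) * Real.sin q.2)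
          + b.2 * sn κ (ρ q.1) * Real.cos q.2,
        b.1 * deriv ρ q.1 * (radius κ * (-κ * sn κ (ρ q.1))),
        b.1 * deriv t q.1] : Fin 4 → ℝ) i)
      ((![_, _, _, _] : Fin 4 → (ℝ × ℝ →L[ℝ] ℝ)) i) p)
  have hmem : {q : ℝ × ℝ | q.1 ∈ J} ∈ nhds p :=
    (h.isOpen.preimage continuous_fst).mem_nhds hp
  have heq : (fun q => fderiv ℝ (revolution κ ρ t) q b) =ᶠ[nhds p]
      fun q : ℝ × ℝ => ![b.1 * deriv ρ q.1 * (cs κ (ρ q.1) * Real.cos q.2)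
          - b.2 * sn κ (ρ q.1) * Real.sin q.2,
        b.1 * deriv ρ q.1 * (cs κ (ρ q.1) * Real.sin q.2)
          + b.2 * sn κ (ρ q.1) * Real.cos q.2,
        b.1 * deriv ρ q.1 * (radius κ * (-κ * sn κ (ρ q.1))),
        b.1 * deriv t q.1] := by
    filter_upwards [hmem] with q hq
    rw [fderiv_revolution (h.differentiableAt_rho hq) (h.differentiableAt_t hq)]
    ext i
    fin_cases i <;> simp [dRho, dT] <;> ring
  rw [secondDeriv, heq.fderiv_eq, show fderiv ℝ _ p = _ from key.fderiv]
  ext i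
  fin_cases i <;> simp [dRho, dT, horizontal, revolution, cylindrical] <;> ring

theorem firstForm_revolution {κ ε : ℝ} (hκ : κ ≠ 0) {J : Set ℝ} {ρ t : ℝ → ℝ}
    (h : IsProfile κ ε J ρ t) {p : ℝ × ℝ} (hp : p.1 ∈ J) (a b : ℝ × ℝ) :
    firstForm κ ε (revolution κ ρ t) p a b =
      a.1 * b.1 * profileSpeed ε ρ t p.1 ^ 2 + a.2 * b.2 * sn κ (ρ p.1) ^ 2 := by
  have hrk : Real.sign κ * radius κ ^ 2 * κ = 1 := by
    rw [sign_mul_radius_sq hκ]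
    field_simp
  have hc := cs_sq_add κ (ρ p.1)
  have htr := Real.sin_sq_add_cos_sq p.2
  rw [firstForm, fderiv_revolution (h.differentiableAt_rho hp) (h.differentiableAt_t hp),
    fderiv_revolution (h.differentiableAt_rho hp) (h.differentiableAt_t hp),
    h.profileSpeed_sq hp]
  simp [metric, dRho, dT]
  linear_combination a.1 * b.1 * deriv ρ p.1 ^ 2 *
      (cs κ (ρ p.1) ^ 2 * htr + κ * sn κ (ρ p.1) ^ 2 * hrk + hc)
    + a.2 * b.2 * sn κ (ρ p.1) ^ 2 * htr

theorem revolutionNormal_eq {κ ε : ℝ} {J : Set ℝ} {ρ t : ℝ → ℝ}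
    (h : IsProfile κ ε J ρ t) {p : ℝ × ℝ} (hp : p.1 ∈ J) :
    revolutionNormal κ ε ρ t p = (profileSpeed ε ρ t p.1)⁻¹ •
      (deriv t p.1 • dRho κ (ρ p.1) p.2 - (ε * deriv ρ p.1) • dT) := by
  have hS := (h.sn_rho_pos hp).ne'
  rw [revolutionNormal, h.areaDensity_eq hp, mul_inv, mul_comm _ (profileSpeed ε ρ t p.1)⁻¹,
    mul_smul, smul_sub, smul_smul, smul_smul]
  congr 3 <;> field_simp

theorem secondForm_revolutionNormal {κ ε : ℝ} (hκ : κ ≠ 0) (hε : ε = 1 ∨ ε = -1) {J : Set ℝ}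
    {ρ t : ℝ → ℝ} (h : IsProfile κ ε J ρ t) {p : ℝ × ℝ} (hp : p.1 ∈ J) (a b : ℝ × ℝ) :
    secondForm κ ε (revolution κ ρ t) (revolutionNormal κ ε ρ t p) p a b =
      a.1 * b.1 * ((deriv (deriv ρ) p.1 * deriv t p.1 - deriv ρ p.1 * deriv (deriv t) p.1)
        / profileSpeed ε ρ t p.1)
      - a.2 * b.2 * (sn κ (ρ p.1) * cs κ (ρ p.1) * deriv t p.1 / profileSpeed ε ρ t p.1) := by
  have hε2 : ε ^ 2 = 1 := by rcases hε with rfl | rfl <;> norm_num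
  have hrk : Real.sign κ * radius κ ^ 2 * κ = 1 := by
    rw [sign_mul_radius_sq hκ]
    field_simp
  have hc := cs_sq_add κ (ρ p.1)
  have htr := Real.sin_sq_add_cos_sq p.2
  rw [secondForm, secondDeriv_revolution h hp, revolutionNormal_eq h hp]
  simp [metric, dRho, dT, horizontal, revolution, cylindrical]
  linear_combination (profileSpeed ε ρ t p.1)⁻¹ *
    (a.1 * b.1 * deriv (deriv ρ) p.1 * deriv t p.1 *
        (cs κ (ρ p.1) ^ 2 * htr + κ * sn κ (ρ p.1) ^ 2 * hrk + hc)
      - a.1 * b.1 * deriv (deriv t) p.1 * deriv ρ p.1 * hε2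
      - a.1 * b.1 * deriv ρ p.1 ^ 2 * κ * deriv t p.1 * sn κ (ρ p.1) * cs κ (ρ p.1)
        * (htr - hrk)
      - a.2 * b.2 * sn κ (ρ p.1) * deriv t p.1 * cs κ (ρ p.1) * htr)

theorem secondForm_horizontal {κ ε : ℝ} (hκ : κ ≠ 0) {J : Set ℝ}
    {ρ t : ℝ → ℝ} (h : IsProfile κ ε J ρ t) {p : ℝ × ℝ} (hp : p.1 ∈ J) (a b : ℝ × ℝ) :
    secondForm κ ε (revolution κ ρ t) ((1 / radius κ) • horizontal (revolution κ ρ t p)) p a b =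
      -(1 / radius κ) * (a.1 * b.1 * deriv ρ p.1 ^ 2 + a.2 * b.2 * sn κ (ρ p.1) ^ 2) := by
  have hrk : Real.sign κ * radius κ ^ 2 * κ = 1 := by
    rw [sign_mul_radius_sq hκ]
    field_simp
  have hc := cs_sq_add κ (ρ p.1)
  have htr := Real.sin_sq_add_cos_sq p.2
  rw [secondForm, secondDeriv_revolution h hp]
  simp [metric, dRho, dT, horizontal, revolution, cylindrical]
  linear_combination (radius κ)⁻¹ *
    (a.1 * b.1 * deriv (deriv ρ) p.1 * sn κ (ρ p.1) * cs κ (ρ p.1) * (htr - hrk)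
      - a.1 * b.1 * deriv ρ p.1 ^ 2 *
        (κ * sn κ (ρ p.1) ^ 2 * htr + cs κ (ρ p.1) ^ 2 * hrk + hc)
      - a.2 * b.2 * sn κ (ρ p.1) ^ 2 * htr)

theorem meanCurvature_revolution {κ ε : ℝ} (hκ : κ ≠ 0) (hε : ε = 1 ∨ ε = -1) {J : Set ℝ}
    {ρ t : ℝ → ℝ} (h : IsProfile κ ε J ρ t) {p : ℝ × ℝ} (hp : p.1 ∈ J) :
    meanCurvature κ ε (revolution κ ρ t) (revolutionNormal κ ε ρ t) p =
      ((deriv (deriv ρ) p.1 * deriv t p.1 - deriv ρ p.1 * deriv (deriv t) p.1)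
          / profileSpeed ε ρ t p.1 ^ 3
        - cs κ (ρ p.1) * deriv t p.1 / (sn κ (ρ p.1) * profileSpeed ε ρ t p.1)) / 2 := by
  have hv := (h.profileSpeed_pos hp).ne'
  have hS := (h.sn_rho_pos hp).ne'
  simp only [meanCurvature, firstForm_revolution hκ h hp, secondForm_revolutionNormal hκ hε h hp]
  norm_num
  field_simp
  ring

theorem hasMeanCurvature_iff {κ ε : ℝ} (hκ : κ ≠ 0) (hε : ε = 1 ∨ ε = -1) {J : Set ℝ}
    {ρ t : ℝ → ℝ} (h : IsProfile κ ε J ρ t) {H : ℝ} :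
    HasMeanCurvature κ ε J ρ t H ↔ ∀ s ∈ J,
      (deriv (deriv ρ) s * deriv t s - deriv ρ s * deriv (deriv t) s) * sn κ (ρ s) =
        2 * H * sn κ (ρ s) * profileSpeed ε ρ t s ^ 3
          + cs κ (ρ s) * deriv t s * profileSpeed ε ρ t s ^ 2 := by
  have key : ∀ p : ℝ × ℝ, p.1 ∈ J →
      (meanCurvature κ ε (revolution κ ρ t) (revolutionNormal κ ε ρ t) p = H ↔
        (deriv (deriv ρ) p.1 * deriv t p.1 - deriv ρ p.1 * deriv (deriv t) p.1) * sn κ (ρ p.1) =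
        2 * H * sn κ (ρ p.1) * profileSpeed ε ρ t p.1 ^ 3
          + cs κ (ρ p.1) * deriv t p.1 * profileSpeed ε ρ t p.1 ^ 2) := fun p hp => by
    have hv := (h.profileSpeed_pos hp).ne'
    have hS := (h.sn_rho_pos hp).ne'
    rw [meanCurvature_revolution hκ hε h hp]
    field_simp
    constructor <;> intro h1 <;> linear_combination h1
  exact ⟨fun h1 s hs => (key (s, 0) hs).1 (h1 _ ⟨hs, trivial⟩),
    fun h1 p hp => (key p hp.1).2 (h1 _ hp.1)⟩

/-! ### The quadratic differential and the first integral -/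

theorem sign_div_radius_div_radius (κ : ℝ) :
    Real.sign κ / radius κ * (1 / radius κ) = κ := by
  unfold radius
  rw [one_div_one_div, div_div_eq_mul_div, div_one, mul_assoc,
    Real.mul_self_sqrt (abs_nonneg κ)]
  rcases lt_trichotomy κ 0 with h | h | h
  · rw [Real.sign_of_neg h, abs_of_neg h]
    ring
  · simp [h]
  · rw [Real.sign_of_pos h, abs_of_pos h, one_mul]

/-- The quadratic differential `Q` is the trace-free part of a quadratic form which is diagonal in
the coordinates `(s, θ)`; it vanishes when that form is a multiple of the metric. -/
theorem qVanishes_iff {κ ε : ℝ} (hκ : κ ≠ 0) (hε : ε = 1 ∨ ε = -1) {J : Set ℝ}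
    {ρ t : ℝ → ℝ} (h : IsProfile κ ε J ρ t) {H : ℝ} (hH : HasMeanCurvature κ ε J ρ t H) :
    QVanishes κ ε J ρ t ↔ ∀ s ∈ J,
      4 * H ^ 2 * sn κ (ρ s) * profileSpeed ε ρ t s ^ 2
        + 4 * H * cs κ (ρ s) * deriv t s * profileSpeed ε ρ t s
      = κ * sn κ (ρ s) * deriv t s ^ 2 := by
  have hε2 : ε ^ 2 = 1 := by rcases hε with rfl | rfl <;> norm_num
  obtain ⟨D, hD⟩ : ∃ D : ℝ → ℝ, ∀ s, D s =
    deriv (deriv ρ) s * deriv t s - deriv ρ s * deriv (deriv t) s := ⟨_, fun _ => rfl⟩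
  have hD' := (hasMeanCurvature_iff hκ hε h).1 hH
  simp only [← hD] at hD'
  have hK : ∀ p : ℝ × ℝ, p.1 ∈ J → ∀ a b : ℝ × ℝ,
      2 * H * secondForm κ ε (revolution κ ρ t) (revolutionNormal κ ε ρ t p) p a b
        - ε * (Real.sign κ / radius κ) * secondForm κ ε (revolution κ ρ t)
          ((1 / radius κ) • horizontal (revolution κ ρ t p)) p a b
      = a.1 * b.1 * (2 * H * D p.1 / profileSpeed ε ρ t p.1 + ε * κ * deriv ρ p.1 ^ 2)
        + a.2 * b.2 * (ε * κ * sn κ (ρ p.1) ^ 2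
          - 2 * H * sn κ (ρ p.1) * cs κ (ρ p.1) * deriv t p.1 / profileSpeed ε ρ t p.1) :=
    fun p hp a b => by
      rw [secondForm_revolutionNormal hκ hε h hp, secondForm_horizontal hκ h hp, hD]
      linear_combination ε * (a.1 * b.1 * deriv ρ p.1 ^ 2 + a.2 * b.2 * sn κ (ρ p.1) ^ 2)
        * sign_div_radius_div_radius κ
  have hq : ∀ p : ℝ × ℝ, p.1 ∈ J → ∀ a b : ℝ × ℝ,
      qCoeff κ ε (revolution κ ρ t) (revolutionNormal κ ε ρ t) p a b = 0 ↔
        (a.1 * a.1 - b.1 * b.1) *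
            (2 * H * D p.1 / profileSpeed ε ρ t p.1 + ε * κ * deriv ρ p.1 ^ 2)
          + (a.2 * a.2 - b.2 * b.2) * (ε * κ * sn κ (ρ p.1) ^ 2
            - 2 * H * sn κ (ρ p.1) * cs κ (ρ p.1) * deriv t p.1 / profileSpeed ε ρ t p.1) = 0 ∧
        a.1 * b.1 * (2 * H * D p.1 / profileSpeed ε ρ t p.1 + ε * κ * deriv ρ p.1 ^ 2)
          + a.2 * b.2 * (ε * κ * sn κ (ρ p.1) ^ 2
            - 2 * H * sn κ (ρ p.1) * cs κ (ρ p.1) * deriv t p.1 / profileSpeed ε ρ t p.1) = 0 :=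
    fun p hp a b => by
      have e1 := hK p hp a a
      have e2 := hK p hp b b
      have e3 := hK p hp a b
      rw [Complex.ext_iff, qCoeff, hH p ⟨hp, trivial⟩, hopfCoeff, hopfCoeff, ← e3]
      simp [-one_div]
      refine and_congr ⟨fun h => ?_, fun h => ?_⟩ ⟨fun h => ?_, fun h => ?_⟩
      · linear_combination 2 * h - e1 + e2
      · linear_combination (h + e1 - e2) / 2
      · linear_combination -h
      · linear_combination -h
  have hcrit : ∀ p : ℝ × ℝ, p.1 ∈ J →
      ((2 * H * D p.1 / profileSpeed ε ρ t p.1 + ε * κ * deriv ρ p.1 ^ 2) * sn κ (ρ p.1) ^ 2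
        = (ε * κ * sn κ (ρ p.1) ^ 2
            - 2 * H * sn κ (ρ p.1) * cs κ (ρ p.1) * deriv t p.1 / profileSpeed ε ρ t p.1)
          * profileSpeed ε ρ t p.1 ^ 2 ↔
      4 * H ^ 2 * sn κ (ρ p.1) * profileSpeed ε ρ t p.1 ^ 2
        + 4 * H * cs κ (ρ p.1) * deriv t p.1 * profileSpeed ε ρ t p.1
      = κ * sn κ (ρ p.1) * deriv t p.1 ^ 2) := fun p hp => by
    have hv := (h.profileSpeed_pos hp).ne'
    have hv2 := h.profileSpeed_sq hp
    have hS := (h.sn_rho_pos hp).ne'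
    have hd := hD' p.1 hp
    have e : ((2 * H * D p.1 / profileSpeed ε ρ t p.1 + ε * κ * deriv ρ p.1 ^ 2)
          * sn κ (ρ p.1) ^ 2
        - (ε * κ * sn κ (ρ p.1) ^ 2
            - 2 * H * sn κ (ρ p.1) * cs κ (ρ p.1) * deriv t p.1 / profileSpeed ε ρ t p.1)
          * profileSpeed ε ρ t p.1 ^ 2) =
      sn κ (ρ p.1) * (4 * H ^ 2 * sn κ (ρ p.1) * profileSpeed ε ρ t p.1 ^ 2
        + 4 * H * cs κ (ρ p.1) * deriv t p.1 * profileSpeed ε ρ t p.1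
        - κ * sn κ (ρ p.1) * deriv t p.1 ^ 2) := by
      have hρ : ε * deriv ρ p.1 ^ 2 = ε * profileSpeed ε ρ t p.1 ^ 2 - deriv t p.1 ^ 2 := by
        linear_combination -deriv t p.1 ^ 2 * hε2 - ε * hv2
      field_simp
      linear_combination 2 * H * hd + κ * sn κ (ρ p.1) * profileSpeed ε ρ t p.1 * hρ
    rw [← sub_eq_zero, e, mul_eq_zero, or_iff_right hS, sub_eq_zero]
  constructor
  · intro hQ s hs
    have hv := h.profileSpeed_pos hs
    have hS := h.sn_rho_pos hs
    -- the frame `(∂_s, ∂_θ)`, rescaled so as to be conformal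
    have h1 := (hq (s, 0) hs (sn κ (ρ s), 0) (0, profileSpeed ε ρ t s)).1
      (hQ (s, 0) ⟨hs, trivial⟩ _ _ ⟨by
        rw [firstForm_revolution hκ h hs, firstForm_revolution hκ h hs]; simp; ring, by
        rw [firstForm_revolution hκ h hs]; simp, by
        rw [firstForm_revolution hκ h hs]; simp; positivity⟩)
    refine (hcrit (s, 0) hs).1 ?_
    linear_combination h1.1
  · rintro h1 p ⟨hp, -⟩ a b ⟨h2, h3, -⟩
    rw [firstForm_revolution hκ h hp] at h2 h3
    rw [firstForm_revolution hκ h hp] at h2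
    have hv := h.profileSpeed_pos hp
    have h4 := (hcrit p hp).2 (h1 p.1 hp)
    rw [hq p hp]
    generalize 2 * H * D p.1 / profileSpeed ε ρ t p.1 + ε * κ * deriv ρ p.1 ^ 2 = k₁ at *
    generalize ε * κ * sn κ (ρ p.1) ^ 2 - 2 * H * sn κ (ρ p.1) * cs κ (ρ p.1) * deriv t p.1
      / profileSpeed ε ρ t p.1 = k₂ at *
    have hv2 : profileSpeed ε ρ t p.1 ^ 2 ≠ 0 := (pow_pos hv 2).ne'
    constructor
    · refine (mul_eq_zero.1 ?_).resolve_left hv2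
      linear_combination k₁ * h2 - (a.2 * a.2 - b.2 * b.2) * h4
    · refine (mul_eq_zero.1 ?_).resolve_left hv2
      linear_combination k₁ * h3 - a.2 * b.2 * h4

theorem hasFirstIntegral_iff {κ ε : ℝ} {J : Set ℝ} {ρ t : ℝ → ℝ} (h : IsProfile κ ε J ρ t)
    {H I : ℝ} : HasFirstIntegral κ ε J ρ t H I ↔ ∀ s ∈ J,
      deriv t s * sn κ (ρ s) / profileSpeed ε ρ t s = I + 2 * H * cs κ (ρ s) / κ := by
  refine forall₂_congr fun s hs => ?_
  have hv := (h.profileSpeed_pos hs).ne'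
  have hS := (h.sn_rho_pos hs).ne'
  rw [h.areaDensity_eq hs,
    show deriv t s * sn κ (ρ s) ^ 2 / (sn κ (ρ s) * profileSpeed ε ρ t s)
      = deriv t s * sn κ (ρ s) / profileSpeed ε ρ t s by field_simp,
    show I - 2 * H * (-cs κ (ρ s) / κ) = I + 2 * H * cs κ (ρ s) / κ by ring]

theorem IsProfile.hasDerivAt_sn_rho {κ ε : ℝ} {J : Set ℝ} {ρ t : ℝ → ℝ}
    (h : IsProfile κ ε J ρ t) {s : ℝ} (hs : s ∈ J) :
    HasDerivAt (fun s => sn κ (ρ s)) (cs κ (ρ s) * deriv ρ s) s :=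
  (hasDerivAt_sn κ (ρ s)).comp s (h.differentiableAt_rho hs).hasDerivAt

theorem IsProfile.hasDerivAt_cs_rho {κ ε : ℝ} {J : Set ℝ} {ρ t : ℝ → ℝ}
    (h : IsProfile κ ε J ρ t) {s : ℝ} (hs : s ∈ J) :
    HasDerivAt (fun s => cs κ (ρ s)) (-κ * sn κ (ρ s) * deriv ρ s) s :=
  (hasDerivAt_cs κ (ρ s)).comp s (h.differentiableAt_rho hs).hasDerivAt

theorem IsProfile.hasDerivAt_profileSpeed {κ ε : ℝ} {J : Set ℝ} {ρ t : ℝ → ℝ}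
    (h : IsProfile κ ε J ρ t) {s : ℝ} (hs : s ∈ J) :
    HasDerivAt (profileSpeed ε ρ t)
      ((deriv ρ s * deriv (deriv ρ) s + ε * (deriv t s * deriv (deriv t) s))
        / profileSpeed ε ρ t s) s := by
  have h1 := ((((h.hasDerivAt_deriv_rho hs).pow 2).add
    (((h.hasDerivAt_deriv_t hs).pow 2).const_mul ε))).sqrt (h.spacelike s hs).ne'
  refine h1.congr_deriv ?_
  have hv := (h.profileSpeed_pos hs).ne'
  unfold profileSpeed at hv ⊢
  simp only [Pi.add_apply, Pi.pow_apply]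
  field_simp
  norm_num
  ring

/-- Along a surface of constant mean curvature the first integral has zero derivative. -/
theorem exists_hasFirstIntegral {κ ε : ℝ} (hκ : κ ≠ 0) (hε : ε = 1 ∨ ε = -1) {J : Set ℝ}
    {ρ t : ℝ → ℝ} (h : IsProfile κ ε J ρ t) {H : ℝ} (hH : HasMeanCurvature κ ε J ρ t H) :
    ∃ I, HasFirstIntegral κ ε J ρ t H I := by
  obtain ⟨s₀, hs₀⟩ := h.nonempty
  have h0 : ∀ s ∈ J, HasDerivAt (fun s => deriv t s * sn κ (ρ s) / profileSpeed ε ρ t s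
      - 2 * H * cs κ (ρ s) / κ) 0 s := fun s hs => by
    have hv := (h.profileSpeed_pos hs).ne'
    have hv2 := h.profileSpeed_sq hs
    have hd := (hasMeanCurvature_iff hκ hε h).1 hH s hs
    refine ((((h.hasDerivAt_deriv_t hs).mul (h.hasDerivAt_sn_rho hs)).div
      (h.hasDerivAt_profileSpeed hs) hv).sub
      (((h.hasDerivAt_cs_rho hs).const_mul (2 * H)).div_const κ)).congr_deriv ?_
    simp only [Pi.mul_apply]
    field_simp
    linear_combination deriv (deriv t) s * sn κ (ρ s) * hv2 - deriv ρ s * hd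
  refine ⟨deriv t s₀ * sn κ (ρ s₀) / profileSpeed ε ρ t s₀ - 2 * H * cs κ (ρ s₀) / κ,
    (hasFirstIntegral_iff h).2 fun s hs => ?_⟩
  have := h.isOpen.is_const_of_deriv_eq_zero h.ordConnected.isPreconnected
    (fun x hx => (h0 x hx).differentiableAt.differentiableWithinAt)
    (fun x hx => (h0 x hx).deriv) hs hs₀
  linear_combination this

theorem HasFirstIntegral.unique {κ ε : ℝ} {J : Set ℝ} {ρ t : ℝ → ℝ} (h : IsProfile κ ε J ρ t)
    {H I I' : ℝ} (h1 : HasFirstIntegral κ ε J ρ t H I) (h2 : HasFirstIntegral κ ε J ρ t H I') :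
    I = I' := by
  obtain ⟨s₀, hs₀⟩ := h.nonempty
  linear_combination h2 s₀ hs₀ - h1 s₀ hs₀

theorem qVanishes_iff_firstIntegral {κ ε : ℝ} (hκ : κ ≠ 0) (hε : ε = 1 ∨ ε = -1) {J : Set ℝ}
    {ρ t : ℝ → ℝ} (h : IsProfile κ ε J ρ t) {H I : ℝ} (hH : HasMeanCurvature κ ε J ρ t H)
    (hI : HasFirstIntegral κ ε J ρ t H I) :
    QVanishes κ ε J ρ t ↔ I = -2 * H / κ ∨ I = 2 * H / κ := by
  have h1 : I = -2 * H / κ ∨ I = 2 * H / κ ↔ κ ^ 2 * I ^ 2 = 4 * H ^ 2 := by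
    rw [eq_div_iff hκ, eq_div_iff hκ, or_comm, neg_mul, ← sq_eq_sq_iff_eq_or_eq_neg]
    constructor <;> intro h <;> linear_combination h
  rw [h1, qVanishes_iff hκ hε h hH]
  have key : ∀ s ∈ J, (4 * H ^ 2 * sn κ (ρ s) * profileSpeed ε ρ t s ^ 2
        + 4 * H * cs κ (ρ s) * deriv t s * profileSpeed ε ρ t s
      = κ * sn κ (ρ s) * deriv t s ^ 2 ↔ κ ^ 2 * I ^ 2 = 4 * H ^ 2) := fun s hs => by
    have hv := (h.profileSpeed_pos hs).ne'
    have hS := (h.sn_rho_pos hs).ne'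
    have hc := cs_sq_add κ (ρ s)
    have hP := (hasFirstIntegral_iff h).1 hI s hs
    have ht : deriv t s = (I + 2 * H * cs κ (ρ s) / κ) * profileSpeed ε ρ t s / sn κ (ρ s) := by
      rw [← hP]
      field_simp
    rw [ht]
    field_simp
    constructor
    · intro h2
      linear_combination -h2 + 4 * H ^ 2 * hc
    · intro h2
      linear_combination -h2 + 4 * H ^ 2 * hc
  obtain ⟨s₀, hs₀⟩ := h.nonempty
  exact ⟨fun h2 => (key s₀ hs₀).1 (h2 s₀ hs₀), fun h2 s hs => (key s hs).2 h2⟩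

/-- The minimal surfaces with `Q = 0` are the horizontal ones. -/
theorem hasMeanCurvature_zero_and_qVanishes_iff {κ ε : ℝ} (hκ : κ ≠ 0) (hε : ε = 1 ∨ ε = -1)
    {J : Set ℝ} {ρ t : ℝ → ℝ} (h : IsProfile κ ε J ρ t) :
    (HasMeanCurvature κ ε J ρ t 0 ∧ QVanishes κ ε J ρ t) ↔ ∃ t₀ : ℝ, ∀ s ∈ J, t s = t₀ := by
  constructor
  · rintro ⟨hH, hQ⟩
    have h1 := (qVanishes_iff hκ hε h hH).1 hQ
    obtain ⟨s₀, hs₀⟩ := h.nonempty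
    refine ⟨t s₀, fun s hs => h.isOpen.is_const_of_deriv_eq_zero h.ordConnected.isPreconnected
      (fun x hx => (h.differentiableAt_t hx).differentiableWithinAt) (fun x hx => ?_) hs hs₀⟩
    have := h1 x hx
    have hS := (h.sn_rho_pos hx).ne'
    simp only [ne_eq, OfNat.ofNat_ne_zero, not_false_eq_true, zero_pow, mul_zero, zero_mul,
      add_zero, zero_eq_mul, pow_eq_zero_iff] at this
    exact this.resolve_left (mul_ne_zero hκ hS)
  · rintro ⟨t₀, ht₀⟩
    have hd : ∀ s ∈ J, deriv t s = 0 := fun s hs => by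
      rw [(Filter.eventuallyEq_of_mem (h.isOpen.mem_nhds hs) ht₀ :
        t =ᶠ[nhds s] fun _ => t₀).deriv_eq]
      simp
    have hdd : ∀ s ∈ J, deriv (deriv t) s = 0 := fun s hs => by
      rw [(Filter.eventuallyEq_of_mem (h.isOpen.mem_nhds hs) hd :
        deriv t =ᶠ[nhds s] fun _ => 0).deriv_eq]
      simp
    have hH : HasMeanCurvature κ ε J ρ t 0 :=
      (hasMeanCurvature_iff hκ hε h).2 fun s hs => by simp [hd s hs, hdd s hs]
    exact ⟨hH, (qVanishes_iff hκ hε h hH).2 fun s hs => by simp [hd s hs]⟩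

/-! ### The profile curves with `Q = 0` -/

theorem IsProfile.sn_half_pos {κ ε : ℝ} {J : Set ℝ} {ρ t : ℝ → ℝ}
    (h : IsProfile κ ε J ρ t) {s : ℝ} (hs : s ∈ J) : 0 < sn κ (ρ s / 2) := by
  have := h.rho_pos s hs
  exact sn_pos (by positivity) fun hκ => by linarith [h.rho_lt hκ s hs]

theorem IsProfile.cs_half_pos {κ ε : ℝ} {J : Set ℝ} {ρ t : ℝ → ℝ}
    (h : IsProfile κ ε J ρ t) {s : ℝ} (hs : s ∈ J) : 0 < cs κ (ρ s / 2) := by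
  have h1 := h.sn_rho_pos hs
  rw [sn_eq_half] at h1
  exact pos_of_mul_pos_right h1 (mul_pos two_pos (h.sn_half_pos hs)).le

theorem IsProfile.hasDerivAt_sn_half {κ ε : ℝ} {J : Set ℝ} {ρ t : ℝ → ℝ}
    (h : IsProfile κ ε J ρ t) {s : ℝ} (hs : s ∈ J) :
    HasDerivAt (fun s => sn κ (ρ s / 2)) (cs κ (ρ s / 2) * deriv ρ s / 2) s :=
  ((hasDerivAt_sn κ (ρ s / 2)).comp (h := fun s => ρ s / 2) s
    ((h.differentiableAt_rho hs).hasDerivAt.div_const 2)).congr_deriv (by ring)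

theorem IsProfile.hasDerivAt_cs_half {κ ε : ℝ} {J : Set ℝ} {ρ t : ℝ → ℝ}
    (h : IsProfile κ ε J ρ t) {s : ℝ} (hs : s ∈ J) :
    HasDerivAt (fun s => cs κ (ρ s / 2)) (-κ * sn κ (ρ s / 2) * deriv ρ s / 2) s :=
  ((hasDerivAt_cs κ (ρ s / 2)).comp (h := fun s => ρ s / 2) s
    ((h.differentiableAt_rho hs).hasDerivAt.div_const 2)).congr_deriv (by ring)

/-- The first integral with `I = -2H / κ` determines the slope of the profile curve. -/
theorem hasFirstIntegral_minus_iff {κ ε : ℝ} (hκ : κ ≠ 0) {J : Set ℝ} {ρ t : ℝ → ℝ}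
    (h : IsProfile κ ε J ρ t) {H : ℝ} :
    HasFirstIntegral κ ε J ρ t H (-2 * H / κ) ↔ ∀ s ∈ J,
      deriv t s * cs κ (ρ s / 2) = -2 * H * sn κ (ρ s / 2) * profileSpeed ε ρ t s := by
  rw [hasFirstIntegral_iff h]
  refine forall₂_congr fun s hs => ?_
  have hv := (h.profileSpeed_pos hs).ne'
  have hz := (h.sn_half_pos hs).ne'
  have e : -2 * H / κ + 2 * H * cs κ (ρ s) / κ = -4 * H * sn κ (ρ s / 2) ^ 2 := by
    rw [cs_eq_half κ (ρ s)]
    field_simp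
    ring
  rw [e, sn_eq_half κ (ρ s)]
  field_simp
  constructor <;> intro h1
  · linear_combination h1 / 2
  · linear_combination 2 * h1

/-- The first integral with `I = 2H / κ` determines the slope of the profile curve. -/
theorem hasFirstIntegral_plus_iff {κ ε : ℝ} (hκ : κ ≠ 0) {J : Set ℝ} {ρ t : ℝ → ℝ}
    (h : IsProfile κ ε J ρ t) {H : ℝ} :
    HasFirstIntegral κ ε J ρ t H (2 * H / κ) ↔ ∀ s ∈ J,
      κ * (deriv t s * sn κ (ρ s / 2)) = 2 * H * cs κ (ρ s / 2) * profileSpeed ε ρ t s := by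
  rw [hasFirstIntegral_iff h]
  refine forall₂_congr fun s hs => ?_
  have hv := (h.profileSpeed_pos hs).ne'
  have hu := (h.cs_half_pos hs).ne'
  have hc := cs_sq_add κ (ρ s / 2)
  have e : 2 * H / κ + 2 * H * cs κ (ρ s) / κ = 4 * H * cs κ (ρ s / 2) ^ 2 / κ := by
    rw [cs_eq_half κ (ρ s)]
    field_simp
    linear_combination -4 * H * hc
  rw [e, sn_eq_half κ (ρ s)]
  field_simp
  constructor <;> intro h1
  · linear_combination h1 / 2
  · linear_combination 2 * h1

theorem hasMeanCurvature_iff_half {κ ε : ℝ} (hκ : κ ≠ 0) (hε : ε = 1 ∨ ε = -1) {J : Set ℝ}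
    {ρ t : ℝ → ℝ} (h : IsProfile κ ε J ρ t) {H : ℝ} :
    HasMeanCurvature κ ε J ρ t H ↔ ∀ s ∈ J,
      2 * sn κ (ρ s / 2) * cs κ (ρ s / 2) *
          (deriv (deriv ρ) s * deriv t s - deriv ρ s * deriv (deriv t) s) =
        4 * H * sn κ (ρ s / 2) * cs κ (ρ s / 2) * profileSpeed ε ρ t s ^ 3
          + (1 - 2 * κ * sn κ (ρ s / 2) ^ 2) * deriv t s * profileSpeed ε ρ t s ^ 2 := by
  rw [hasMeanCurvature_iff hκ hε h]
  refine forall₂_congr fun s hs => ?_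
  rw [sn_eq_half κ (ρ s), cs_eq_half κ (ρ s)]
  constructor <;> intro h1 <;> linear_combination h1

/-- The slope given by the first integral is the energy equation for `cs κ (ρ / 2)` as a function
of `t`; the mean curvature equation is its second order equation. -/
theorem solvesLinearODE_cs_half {κ ε : ℝ} (hκ : κ ≠ 0) (hε : ε = 1 ∨ ε = -1) {J : Set ℝ}
    {ρ t : ℝ → ℝ} (h : IsProfile κ ε J ρ t) {H : ℝ} (hH : H ≠ 0)
    (hmc : HasMeanCurvature κ ε J ρ t H) (hI : HasFirstIntegral κ ε J ρ t H (-2 * H / κ)) :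
    SolvesLinearODE J t (κ * (4 * H ^ 2 * ε + κ) / (16 * H ^ 2)) (κ * ε / 4)
      (fun s => cs κ (ρ s / 2)) := by
  rw [hasFirstIntegral_minus_iff hκ h] at hI
  rw [hasMeanCurvature_iff_half hκ hε h] at hmc
  have ht : ∀ s ∈ J, deriv t s ≠ 0 := fun s hs h0 => by
    have h1 := hI s hs
    rw [h0, zero_mul, eq_comm] at h1
    have hv := (h.profileSpeed_pos hs).ne'
    have hz := (h.sn_half_pos hs).ne'
    simp [hv, hz, hH] at h1
  have hz' := fun s (hs : s ∈ J) => h.hasDerivAt_sn_half hs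
  refine ⟨fun s => -κ * (sn κ (ρ s / 2) * deriv ρ s) / 2 / deriv t s, fun s hs => ⟨?_, ?_, ?_⟩⟩
  · refine (h.hasDerivAt_cs_half hs).congr_deriv ?_
    have := ht s hs
    field_simp
  · refine (((((hz' s hs).mul (h.hasDerivAt_deriv_rho hs)).const_mul (-κ)).div_const 2).div
      (h.hasDerivAt_deriv_t hs) (ht s hs)).congr_deriv ?_
    have hu := (h.cs_half_pos hs).ne'
    have ht0 := ht s hs
    have hc := cs_sq_add κ (ρ s / 2)
    have h1 := hI s hs
    have h2 := hmc s hs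
    have hv2 := h.profileSpeed_sq hs
    simp only [Pi.mul_apply]
    generalize deriv t s = t₁ at *
    generalize deriv (deriv t) s = t₂ at *
    generalize deriv ρ s = ρ₁ at *
    generalize deriv (deriv ρ) s = ρ₂ at *
    generalize profileSpeed ε ρ t s = v at *
    generalize cs κ (ρ s / 2) = u at *
    generalize sn κ (ρ s / 2) = z at *
    have h3 : 2 * u * z * (ρ₂ * t₁ - ρ₁ * t₂) = -t₁ * v ^ 2 := by
      linear_combination h2 + 2 * u * v ^ 2 * h1 - 2 * v ^ 2 * t₁ * hc
    have h4 : t₁ ^ 2 * u ^ 2 = 4 * H ^ 2 * z ^ 2 * v ^ 2 := by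
      linear_combination (t₁ * u - 2 * H * z * v) * h1
    field_simp
    refine mul_left_cancel₀ hu ?_
    linear_combination -16 * H ^ 2 * h3 + 16 * H ^ 2 * t₁ * u ^ 2 * hv2
      - 16 * H ^ 2 * v ^ 2 * t₁ * hc - 4 * κ * t₁ * h4
  · have ht0 := ht s hs
    have hc := cs_sq_add κ (ρ s / 2)
    have h1 := hI s hs
    have hv2 := h.profileSpeed_sq hs
    have h4 : deriv t s ^ 2 * cs κ (ρ s / 2) ^ 2
        = 4 * H ^ 2 * sn κ (ρ s / 2) ^ 2 * profileSpeed ε ρ t s ^ 2 := by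
      linear_combination (deriv t s * cs κ (ρ s / 2)
        - 2 * H * sn κ (ρ s / 2) * profileSpeed ε ρ t s) * h1
    rw [hv2] at h4
    field_simp
    linear_combination 16 * κ * h4 + 64 * H ^ 2 * ε * deriv t s ^ 2 * hc

/-- The slope given by the first integral is the energy equation for `sn κ (ρ / 2)` as a function
of `t`; the mean curvature equation is its second order equation. -/
theorem solvesLinearODE_sn_half {κ ε : ℝ} (hκ : κ ≠ 0) (hε : ε = 1 ∨ ε = -1) {J : Set ℝ}
    {ρ t : ℝ → ℝ} (h : IsProfile κ ε J ρ t) {H : ℝ} (hH : H ≠ 0)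
    (hmc : HasMeanCurvature κ ε J ρ t H) (hI : HasFirstIntegral κ ε J ρ t H (2 * H / κ)) :
    SolvesLinearODE J t (κ * (4 * H ^ 2 * ε + κ) / (16 * H ^ 2)) (ε / 4)
      (fun s => sn κ (ρ s / 2)) := by
  rw [hasFirstIntegral_plus_iff hκ h] at hI
  rw [hasMeanCurvature_iff_half hκ hε h] at hmc
  have ht : ∀ s ∈ J, deriv t s ≠ 0 := fun s hs h0 => by
    have h1 := hI s hs
    rw [h0, zero_mul, mul_zero, eq_comm] at h1
    have hv := (h.profileSpeed_pos hs).ne'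
    have hu := (h.cs_half_pos hs).ne'
    simp [hv, hu, hH] at h1
  have hu' := fun s (hs : s ∈ J) => h.hasDerivAt_cs_half hs
  refine ⟨fun s => cs κ (ρ s / 2) * deriv ρ s / 2 / deriv t s, fun s hs => ⟨?_, ?_, ?_⟩⟩
  · refine (h.hasDerivAt_sn_half hs).congr_deriv ?_
    have := ht s hs
    field_simp
  · refine ((((hu' s hs).mul (h.hasDerivAt_deriv_rho hs)).div_const 2).div
      (h.hasDerivAt_deriv_t hs) (ht s hs)).congr_deriv ?_
    have hz := (h.sn_half_pos hs).ne'
    have ht0 := ht s hs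
    have hc := cs_sq_add κ (ρ s / 2)
    have h1 := hI s hs
    have h2 := hmc s hs
    have hv2 := h.profileSpeed_sq hs
    simp only [Pi.mul_apply]
    generalize deriv t s = t₁ at *
    generalize deriv (deriv t) s = t₂ at *
    generalize deriv ρ s = ρ₁ at *
    generalize deriv (deriv ρ) s = ρ₂ at *
    generalize profileSpeed ε ρ t s = v at *
    generalize cs κ (ρ s / 2) = u at *
    generalize sn κ (ρ s / 2) = z at *
    have h3 : 2 * u * z * (ρ₂ * t₁ - ρ₁ * t₂) = t₁ * v ^ 2 := by
      linear_combination h2 - 2 * z * v ^ 2 * h1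
    have h4 : κ ^ 2 * t₁ ^ 2 * z ^ 2 = 4 * H ^ 2 * u ^ 2 * v ^ 2 := by
      linear_combination (κ * t₁ * z + 2 * H * u * v) * h1
    field_simp
    refine mul_left_cancel₀ hz ?_
    linear_combination 16 * H ^ 2 * h3 + 16 * H ^ 2 * t₁ * κ * z ^ 2 * hv2
      - 16 * H ^ 2 * v ^ 2 * t₁ * hc - 4 * t₁ * h4
  · have ht0 := ht s hs
    have hc := cs_sq_add κ (ρ s / 2)
    have h1 := hI s hs
    have hv2 := h.profileSpeed_sq hs
    have h4 : κ ^ 2 * deriv t s ^ 2 * sn κ (ρ s / 2) ^ 2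
        = 4 * H ^ 2 * cs κ (ρ s / 2) ^ 2 * profileSpeed ε ρ t s ^ 2 := by
      linear_combination (κ * deriv t s * sn κ (ρ s / 2)
        + 2 * H * cs κ (ρ s / 2) * profileSpeed ε ρ t s) * h1
    rw [hv2] at h4
    field_simp
    linear_combination 16 * h4 + 64 * H ^ 2 * ε * deriv t s ^ 2 * hc

/-- Converse of `solvesLinearODE_cs_half`. The equations depend on `H ^ 2` only; the sign of the
mean curvature is opposite to that of `t'`, which has no zeros. -/
theorem exists_hasMeanCurvature_of_cs_half {κ ε : ℝ} (hκ : κ ≠ 0) (hε : ε = 1 ∨ ε = -1)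
    {J : Set ℝ} {ρ t : ℝ → ℝ} (h : IsProfile κ ε J ρ t) {H : ℝ} (hH : H ≠ 0)
    (hode : SolvesLinearODE J t (κ * (4 * H ^ 2 * ε + κ) / (16 * H ^ 2)) (κ * ε / 4)
      (fun s => cs κ (ρ s / 2))) :
    ∃ H', (H' = H ∨ H' = -H) ∧ HasMeanCurvature κ ε J ρ t H' ∧
      HasFirstIntegral κ ε J ρ t H' (-2 * H' / κ) := by
  obtain ⟨w, hw⟩ := hode
  have hwt : ∀ s ∈ J, w s * deriv t s = -κ * (sn κ (ρ s / 2) * deriv ρ s) / 2 := fun s hs => by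
    rw [(hw s hs).1.unique (h.hasDerivAt_cs_half hs)]
    ring
  have hsq : ∀ s ∈ J, deriv t s ^ 2 * cs κ (ρ s / 2) ^ 2
      = 4 * H ^ 2 * sn κ (ρ s / 2) ^ 2 * profileSpeed ε ρ t s ^ 2 := fun s hs => by
    have h1 := (hw s hs).2.2
    have h2 := hwt s hs
    have hc := cs_sq_add κ (ρ s / 2)
    rw [h.profileSpeed_sq hs]
    field_simp at h1
    refine mul_left_cancel₀ (pow_ne_zero 2 hκ) ?_
    linear_combination deriv t s ^ 2 * h1 / 4
      + 16 * H ^ 2 * (w s * deriv t s - κ * (sn κ (ρ s / 2) * deriv ρ s) / 2) * h2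
      - 4 * κ * H ^ 2 * ε * deriv t s ^ 2 * hc
  have hφ : ∃ H', (H' = H ∨ H' = -H) ∧ ∀ s ∈ J,
      deriv t s * cs κ (ρ s / 2) = -2 * H' * sn κ (ρ s / 2) * profileSpeed ε ρ t s := by
    have hcont : ContinuousOn (fun s => deriv t s * cs κ (ρ s / 2)
        / (-2 * sn κ (ρ s / 2) * profileSpeed ε ρ t s)) J := fun s hs =>
      (((h.hasDerivAt_deriv_t hs).continuousAt.mul (h.hasDerivAt_cs_half hs).continuousAt).div
        ((continuousAt_const.mul (h.hasDerivAt_sn_half hs).continuousAt).mul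
        (h.hasDerivAt_profileSpeed hs).continuousAt)
        (mul_ne_zero (mul_ne_zero (by norm_num) (h.sn_half_pos hs).ne')
          (h.profileSpeed_pos hs).ne')).continuousWithinAt
    have h1 := h.ordConnected.isPreconnected.eq_or_eq_neg_of_sq_eq hcont
      (continuousOn_const (c := H)) (fun s hs => by
        have hv := (h.profileSpeed_pos hs).ne'
        have hz := (h.sn_half_pos hs).ne'
        simp only [Pi.pow_apply]
        field_simp
        linear_combination hsq s hs) (fun _ => hH)
    have h2 : ∀ H' s, s ∈ J → deriv t s * cs κ (ρ s / 2)
        / (-2 * sn κ (ρ s / 2) * profileSpeed ε ρ t s) = H' →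
        deriv t s * cs κ (ρ s / 2) = -2 * H' * sn κ (ρ s / 2) * profileSpeed ε ρ t s :=
      fun H' s hs h3 => by
        have hv := (h.profileSpeed_pos hs).ne'
        have hz := (h.sn_half_pos hs).ne'
        rw [← h3]
        field_simp
    rcases h1 with h1 | h1
    · exact ⟨H, Or.inl rfl, fun s hs => h2 H s hs (h1 hs)⟩
    · exact ⟨-H, Or.inr rfl, fun s hs => h2 (-H) s hs (h1 hs)⟩
  obtain ⟨H', hH', hI⟩ := hφ
  refine ⟨H', hH', (hasMeanCurvature_iff_half hκ hε h).2 fun s hs => ?_,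
    (hasFirstIntegral_minus_iff hκ h).2 hI⟩
  have h5 := ((hw s hs).2.1.mul (h.hasDerivAt_deriv_t hs)).unique
    (((((h.hasDerivAt_sn_half hs).mul (h.hasDerivAt_deriv_rho hs)).const_mul
      (-κ)).div_const 2).congr_of_eventuallyEq
      (Filter.eventuallyEq_of_mem (h.isOpen.mem_nhds hs) hwt))
  simp only at h5
  have h6 := hwt s hs
  have hc := cs_sq_add κ (ρ s / 2)
  have h1 := hI s hs
  have h4 := hsq s hs
  have hv2 := h.profileSpeed_sq hs
  generalize deriv t s = t₁ at *
  generalize deriv (deriv t) s = t₂ at *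
  generalize deriv ρ s = ρ₁ at *
  generalize deriv (deriv ρ) s = ρ₂ at *
  generalize profileSpeed ε ρ t s = v at *
  generalize cs κ (ρ s / 2) = u at *
  generalize sn κ (ρ s / 2) = z at *
  have h3 : 2 * u * z * (ρ₂ * t₁ - ρ₁ * t₂) = -t₁ * v ^ 2 := by
    field_simp at h5
    refine mul_left_cancel₀ (mul_ne_zero hκ (pow_ne_zero 2 hH)) ?_
    linear_combination (u * t₁ * h5 - 64 * H ^ 2 * u * t₂ * h6) / 16
      + κ * H ^ 2 * u ^ 2 * t₁ * hv2 - κ * H ^ 2 * t₁ * v ^ 2 * hc - κ ^ 2 * t₁ * h4 / 4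
  linear_combination h3 - 2 * u * v ^ 2 * h1 + 2 * v ^ 2 * t₁ * hc

/-- Converse of `solvesLinearODE_sn_half`. The equations depend on `H ^ 2` only; the sign of the
mean curvature is that of `κ t'`, which has no zeros. -/
theorem exists_hasMeanCurvature_of_sn_half {κ ε : ℝ} (hκ : κ ≠ 0) (hε : ε = 1 ∨ ε = -1)
    {J : Set ℝ} {ρ t : ℝ → ℝ} (h : IsProfile κ ε J ρ t) {H : ℝ} (hH : H ≠ 0)
    (hode : SolvesLinearODE J t (κ * (4 * H ^ 2 * ε + κ) / (16 * H ^ 2)) (ε / 4)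
      (fun s => sn κ (ρ s / 2))) :
    ∃ H', (H' = H ∨ H' = -H) ∧ HasMeanCurvature κ ε J ρ t H' ∧
      HasFirstIntegral κ ε J ρ t H' (2 * H' / κ) := by
  obtain ⟨w, hw⟩ := hode
  have hwt : ∀ s ∈ J, w s * deriv t s = cs κ (ρ s / 2) * deriv ρ s / 2 := fun s hs =>
    (hw s hs).1.unique (h.hasDerivAt_sn_half hs)
  have hsq : ∀ s ∈ J, κ ^ 2 * deriv t s ^ 2 * sn κ (ρ s / 2) ^ 2
      = 4 * H ^ 2 * cs κ (ρ s / 2) ^ 2 * profileSpeed ε ρ t s ^ 2 := fun s hs => by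
    have h1 := (hw s hs).2.2
    have h2 := hwt s hs
    have hc := cs_sq_add κ (ρ s / 2)
    rw [h.profileSpeed_sq hs]
    field_simp at h1
    linear_combination deriv t s ^ 2 * h1 / 4
      + 16 * H ^ 2 * (w s * deriv t s + cs κ (ρ s / 2) * deriv ρ s / 2) * h2
      - 4 * H ^ 2 * ε * deriv t s ^ 2 * hc
  have hφ : ∃ H', (H' = H ∨ H' = -H) ∧ ∀ s ∈ J,
      κ * (deriv t s * sn κ (ρ s / 2)) = 2 * H' * cs κ (ρ s / 2) * profileSpeed ε ρ t s := by
    have hcont : ContinuousOn (fun s => κ * (deriv t s * sn κ (ρ s / 2))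
        / (2 * cs κ (ρ s / 2) * profileSpeed ε ρ t s)) J := fun s hs =>
      ((continuousAt_const.mul ((h.hasDerivAt_deriv_t hs).continuousAt.mul
        (h.hasDerivAt_sn_half hs).continuousAt)).div
        ((continuousAt_const.mul (h.hasDerivAt_cs_half hs).continuousAt).mul
        (h.hasDerivAt_profileSpeed hs).continuousAt)
        (mul_ne_zero (mul_ne_zero (by norm_num) (h.cs_half_pos hs).ne')
          (h.profileSpeed_pos hs).ne')).continuousWithinAt
    have h1 := h.ordConnected.isPreconnected.eq_or_eq_neg_of_sq_eq hcont
      (continuousOn_const (c := H)) (fun s hs => by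
        have hv := (h.profileSpeed_pos hs).ne'
        have hu := (h.cs_half_pos hs).ne'
        simp only [Pi.pow_apply]
        field_simp
        linear_combination hsq s hs) (fun _ => hH)
    have h2 : ∀ H' s, s ∈ J → κ * (deriv t s * sn κ (ρ s / 2))
        / (2 * cs κ (ρ s / 2) * profileSpeed ε ρ t s) = H' →
        κ * (deriv t s * sn κ (ρ s / 2)) = 2 * H' * cs κ (ρ s / 2) * profileSpeed ε ρ t s :=
      fun H' s hs h3 => by
        have hv := (h.profileSpeed_pos hs).ne'
        have hu := (h.cs_half_pos hs).ne'
        rw [← h3]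
        field_simp
    rcases h1 with h1 | h1
    · exact ⟨H, Or.inl rfl, fun s hs => h2 H s hs (h1 hs)⟩
    · exact ⟨-H, Or.inr rfl, fun s hs => h2 (-H) s hs (h1 hs)⟩
  obtain ⟨H', hH', hI⟩ := hφ
  refine ⟨H', hH', (hasMeanCurvature_iff_half hκ hε h).2 fun s hs => ?_,
    (hasFirstIntegral_plus_iff hκ h).2 hI⟩
  have h5 := ((hw s hs).2.1.mul (h.hasDerivAt_deriv_t hs)).unique
    ((((h.hasDerivAt_cs_half hs).mul (h.hasDerivAt_deriv_rho hs)).div_const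
      2).congr_of_eventuallyEq (Filter.eventuallyEq_of_mem (h.isOpen.mem_nhds hs) hwt))
  simp only at h5
  have h6 := hwt s hs
  have hc := cs_sq_add κ (ρ s / 2)
  have h1 := hI s hs
  have h4 := hsq s hs
  have hv2 := h.profileSpeed_sq hs
  generalize deriv t s = t₁ at *
  generalize deriv (deriv t) s = t₂ at *
  generalize deriv ρ s = ρ₁ at *
  generalize deriv (deriv ρ) s = ρ₂ at *
  generalize profileSpeed ε ρ t s = v at *
  generalize cs κ (ρ s / 2) = u at *
  generalize sn κ (ρ s / 2) = z at *
  have h3 : 2 * u * z * (ρ₂ * t₁ - ρ₁ * t₂) = t₁ * v ^ 2 := by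
    field_simp at h5
    refine mul_left_cancel₀ (pow_ne_zero 2 hH) ?_
    linear_combination -(z * t₁ * h5 - 64 * H ^ 2 * z * t₂ * h6) / 16
      - κ * H ^ 2 * z ^ 2 * t₁ * hv2 + H ^ 2 * t₁ * v ^ 2 * hc + t₁ * h4 / 4
  linear_combination h3 + 2 * z * v ^ 2 * h1

/-! ### The equations of the profile curves -/

theorem normalForm_iff_cs {μ δ y τ : ℝ} (h : 0 < μ * δ) :
    NormalForm μ δ y τ ↔ μ * y ^ 2 = δ * cs (-μ) τ ^ 2 := by
  refine ⟨fun h1 => ?_, fun h1 => Or.inl ⟨h, h1⟩⟩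
  rcases h1 with h1 | ⟨h2, h3, -⟩
  · exact h1.2
  · nlinarith

theorem normalForm_iff_sn {μ δ y τ : ℝ} (hμ : 0 ≤ μ) (hδ : δ < 0) :
    NormalForm μ δ y τ ↔ y ^ 2 = -δ * sn (-μ) τ ^ 2 := by
  refine ⟨fun h1 => ?_, fun h1 => Or.inr ⟨hμ, hδ, h1⟩⟩
  rcases h1 with h1 | h1
  · nlinarith [h1.1]
  · exact h1.2.2

theorem not_normalForm {μ δ y τ : ℝ} (hμ : μ ≤ 0) (hδ : 0 < δ) : ¬ NormalForm μ δ y τ := by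
  rintro (h | h)
  · nlinarith [h.1]
  · linarith [h.2.1]

/-- The functions with argument `c τ / 2`, `c ^ 2 = x`, of the equations of the profile curves are
the solutions of `y'' = -(k x / 4) y`. -/
theorem sn_sqrt_mul_div_two {x : ℝ} (hx : 0 < x) (k τ : ℝ) :
    sn k (√x * τ / 2) ^ 2 = x / 4 * sn (k * x / 4) τ ^ 2 := by
  have hc := Real.sqrt_pos.2 hx
  rw [show √x * τ / 2 = √x / 2 * τ by ring, sn_mul (by positivity), mul_pow, div_pow,
    Real.sq_sqrt hx.le]
  norm_num [mul_div_assoc]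

theorem cs_sqrt_mul_div_two {x : ℝ} (hx : 0 < x) (k τ : ℝ) :
    cs k (√x * τ / 2) = cs (k * x / 4) τ := by
  have hc := Real.sqrt_pos.2 hx
  rw [show √x * τ / 2 = √x / 2 * τ by ring, cs_mul (by positivity), div_pow, Real.sq_sqrt hx.le]
  norm_num [mul_div_assoc]

/-- The equations with `I = -2H / κ` are normal forms for `y = cs κ (ρ / 2)`. -/
theorem profileEqMinus_iff {κ ε H ρ τ : ℝ} (hκ : κ ≠ 0) (hε : ε = 1 ∨ ε = -1) (hH : H ≠ 0) :
    ProfileEqMinus κ ε H ρ τ ↔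
      NormalForm (κ * (4 * H ^ 2 * ε + κ) / (16 * H ^ 2)) (κ * ε / 4) (cs κ (ρ / 2)) τ := by
  have hH2 : 0 < H ^ 2 := by positivity
  have hc := cs_sq_add κ (ρ / 2)
  have hM : ε + κ / (4 * H ^ 2) = (4 * H ^ 2 * ε + κ) / (4 * H ^ 2) := by field_simp
  unfold ProfileEqMinus
  rw [hM]
  obtain ⟨M, hMdef⟩ : ∃ M, M = 4 * H ^ 2 * ε + κ := ⟨_, rfl⟩
  rw [← hMdef]
  obtain ⟨μ, hμ⟩ : ∃ μ, μ = κ * M / (16 * H ^ 2) := ⟨_, rfl⟩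
  have hcon := cs_sq_add (-μ) τ
  rw [← hμ]
  rcases lt_trichotomy M 0 with h | h | h
  · have hpos : 0 < -(M / (4 * H ^ 2)) := by
      rw [← neg_div]
      exact div_pos (by linarith) (by positivity)
    rw [sn_sqrt_mul_div_two hpos, show κ * -(M / (4 * H ^ 2)) / 4 = -μ by
      rw [hμ]; field_simp; norm_num]
    rcases hε with rfl | rfl
    · have hκ' : κ < 0 := by linarith
      rw [normalForm_iff_sn (by rw [hμ]; exact div_nonneg (by nlinarith) (by positivity))
        (by linarith)]
      norm_num [h, h.not_gt, h.ne]
      field_simp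
      constructor <;> intro h1
      · refine mul_left_cancel₀ h.ne ?_
        linear_combination -h1
      · linear_combination -M * h1
    · rw [normalForm_iff_cs (by
        rw [hμ, show κ * M / (16 * H ^ 2) * (κ * -1 / 4) = κ ^ 2 * -M / (64 * H ^ 2) by
          field_simp; ring]
        have : 0 < -M := by linarith
        positivity)]
      norm_num [h, h.not_gt, h.ne]
      generalize cs (-μ) τ = c at *
      generalize sn (-μ) τ = σ at *
      rw [hμ] at hcon ⊢
      field_simp at hcon ⊢
      constructor <;> intro h1
      · linear_combination 4 * M * hc - κ * h1 + hcon + 4 * hMdef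
      · refine mul_left_cancel₀ hκ ?_
        linear_combination 4 * M * hc - h1 + hcon + 4 * hMdef
  · have hμ0 : μ = 0 := by rw [hμ, h]; simp
    have hδ : κ * ε / 4 < 0 := by
      rcases hε with rfl | rfl <;> linarith
    rw [normalForm_iff_sn hμ0.ge hδ, hμ0]
    norm_num [h, sn]
    rcases hε with rfl | rfl
    · rw [Real.sign_of_neg (by linarith)]
      field_simp
      constructor <;> intro h1 <;> linear_combination h1
    · rw [Real.sign_of_pos (by linarith)]
      field_simp
      exact eq_comm
  · have hpos : 0 < M / (4 * H ^ 2) := by positivity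
    rw [sn_sqrt_mul_div_two hpos, show -κ * (M / (4 * H ^ 2)) / 4 = -μ by
      rw [hμ]; field_simp; norm_num]
    rcases hε with rfl | rfl
    · rw [normalForm_iff_cs (by
        rw [hμ, show κ * M / (16 * H ^ 2) * (κ * 1 / 4) = κ ^ 2 * M / (64 * H ^ 2) by
          field_simp; norm_num]
        positivity)]
      norm_num [h, h.not_gt, h.ne']
      generalize cs (-μ) τ = c at *
      generalize sn (-μ) τ = σ at *
      rw [hμ] at hcon ⊢
      field_simp at hcon ⊢
      constructor <;> intro h1
      · linear_combination 4 * M * hc - κ * h1 - hcon + 4 * hMdef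
      · refine mul_left_cancel₀ hκ ?_
        linear_combination 4 * M * hc - h1 - hcon + 4 * hMdef
    · have hκ' : 0 < κ := by linarith
      rw [normalForm_iff_sn (by rw [hμ]; positivity) (by linarith)]
      norm_num [h, h.not_gt, h.ne']
      field_simp
      exact eq_comm

/-- The equations with `I = 2H / κ` are normal forms for `y = sn κ (ρ / 2)`. -/
theorem profileEqPlus_iff {κ ε H ρ τ : ℝ} (hκ : κ ≠ 0) (hε : ε = 1 ∨ ε = -1) (hH : H ≠ 0) :
    ProfileEqPlus κ ε H ρ τ ↔
      NormalForm (κ * (4 * H ^ 2 * ε + κ) / (16 * H ^ 2)) (ε / 4) (sn κ (ρ / 2)) τ := by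
  have hH2 : 0 < H ^ 2 := by positivity
  have hM : ε + κ / (4 * H ^ 2) = (4 * H ^ 2 * ε + κ) / (4 * H ^ 2) := by field_simp
  unfold ProfileEqPlus
  rw [hM]
  obtain ⟨M, hMdef⟩ : ∃ M, M = 4 * H ^ 2 * ε + κ := ⟨_, rfl⟩
  rw [← hMdef]
  obtain ⟨μ, hμ⟩ : ∃ μ, μ = κ * M / (16 * H ^ 2) := ⟨_, rfl⟩
  rw [← hμ]
  rcases lt_trichotomy M 0 with h | h | h
  · have hpos : 0 < -(M / (4 * H ^ 2)) := by
      rw [← neg_div]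
      exact div_pos (by linarith) (by positivity)
    rw [sn_sqrt_mul_div_two hpos, cs_sqrt_mul_div_two hpos,
      show κ * -(M / (4 * H ^ 2)) / 4 = -μ by rw [hμ]; field_simp; norm_num]
    rcases hε with rfl | rfl
    · have hκ' : κ < 0 := by linarith
      have hμ0 : 0 < μ := hμ ▸ div_pos (mul_pos_of_neg_of_neg hκ' h) (by positivity)
      rw [normalForm_iff_cs (by linarith)]
      norm_num [h, h.not_gt, h.ne, hκ', hκ'.not_gt]
      rw [hμ]
      field_simp
      constructor <;> intro h1 <;> linarith
    · rcases lt_or_gt_of_ne hκ with hκ' | hκ'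
      · have hμ0 : 0 < μ := hμ ▸ div_pos (mul_pos_of_neg_of_neg hκ' h) (by positivity)
        rw [normalForm_iff_sn hμ0.le (by norm_num)]
        norm_num [h, h.not_gt, h.ne, hκ', hκ'.not_gt]
        field_simp
        constructor <;> intro h1
        · refine mul_left_cancel₀ h.ne ?_
          linear_combination h1
        · linear_combination M * h1
      · have hμ0 : μ < 0 := by
          rw [hμ]
          exact div_neg_of_neg_of_pos (mul_neg_of_pos_of_neg hκ' h) (by positivity)
        rw [normalForm_iff_cs (by linarith)]
        norm_num [h, h.not_gt, h.ne, hκ', hκ'.not_gt]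
        rw [hμ]
        field_simp
        constructor <;> intro h1 <;> linarith
  · have hμ0 : μ = 0 := by rw [hμ, h]; simp
    rcases hε with rfl | rfl
    · refine iff_of_false ?_ (not_normalForm hμ0.le (by norm_num))
      norm_num [h]
    · rw [normalForm_iff_sn hμ0.ge (by norm_num), hμ0]
      rw [show sn (-0) τ = τ by simp [sn]]
      norm_num [h]
      constructor <;> intro h1 <;> linarith
  · have hpos : 0 < M / (4 * H ^ 2) := by positivity
    rw [sn_sqrt_mul_div_two hpos, cs_sqrt_mul_div_two hpos,
      show -κ * (M / (4 * H ^ 2)) / 4 = -μ by rw [hμ]; field_simp; norm_num]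
    rcases hε with rfl | rfl
    · rcases lt_or_gt_of_ne hκ with hκ' | hκ'
      · have hμ0 : μ < 0 := by
          rw [hμ]
          exact div_neg_of_neg_of_pos (mul_neg_of_neg_of_pos hκ' h) (by positivity)
        refine iff_of_false ?_ (not_normalForm hμ0.le (by norm_num))
        norm_num [h.not_gt, h.ne', hκ'.not_gt]
      · have hμ0 : 0 < μ := by rw [hμ]; positivity
        rw [normalForm_iff_cs (by linarith)]
        norm_num [h, h.not_gt, h.ne', hκ', hκ'.not_gt]
        rw [hμ]
        field_simp
        constructor <;> intro h1 <;> linarith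
    · have hκ' : 0 < κ := by linarith
      rw [normalForm_iff_sn (by rw [hμ]; positivity) (by norm_num)]
      norm_num [h, h.not_gt, h.ne', hκ', hκ'.not_gt]
      field_simp

end RevolutionCMC

theorem theorem2 (κ ε : ℝ) (hκ : κ ≠ 0) (hε : ε = 1 ∨ ε = -1)
    (J : Set ℝ) (ρ t : ℝ → ℝ) (hprofile : IsProfile κ ε J ρ t) :
    (∀ H : ℝ, HasMeanCurvature κ ε J ρ t H →
      (∃! I : ℝ, HasFirstIntegral κ ε J ρ t H I) ∧
      ∀ I : ℝ, HasFirstIntegral κ ε J ρ t H I →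
        (QVanishes κ ε J ρ t ↔ I = -2 * H / κ ∨ I = 2 * H / κ)) ∧
    (∀ H : ℝ, H ≠ 0 →
      ((∃ H' : ℝ, (H' = H ∨ H' = -H) ∧ HasMeanCurvature κ ε J ρ t H' ∧
          QVanishes κ ε J ρ t ∧ HasFirstIntegral κ ε J ρ t H' (-2 * H' / κ)) ↔
        ∃ t₀ : ℝ, ∀ s ∈ J, ProfileEqMinus κ ε H (ρ s) (t s - t₀)) ∧
      ((∃ H' : ℝ, (H' = H ∨ H' = -H) ∧ HasMeanCurvature κ ε J ρ t H' ∧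
          QVanishes κ ε J ρ t ∧ HasFirstIntegral κ ε J ρ t H' (2 * H' / κ)) ↔
        ∃ t₀ : ℝ, ∀ s ∈ J, ProfileEqPlus κ ε H (ρ s) (t s - t₀))) ∧
    ((HasMeanCurvature κ ε J ρ t 0 ∧ QVanishes κ ε J ρ t) ↔
      ∃ t₀ : ℝ, ∀ s ∈ J, t s = t₀) := by
  have hne : ∀ {x : ℝ}, x ≠ 0 → x * ε / 4 ≠ 0 := fun hx => by
    rcases hε with rfl | rfl <;> simpa using hx
  refine ⟨fun H hH => ⟨?_, fun I hI => qVanishes_iff_firstIntegral hκ hε hprofile hH hI⟩,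
    fun H hH => ⟨?_, ?_⟩, hasMeanCurvature_zero_and_qVanishes_iff hκ hε hprofile⟩
  · obtain ⟨I, hI⟩ := exists_hasFirstIntegral hκ hε hprofile hH
    exact ⟨I, hI, fun I' hI' => hI'.unique hprofile hI⟩
  · simp only [profileEqMinus_iff hκ hε hH]
    rw [exists_normalForm_iff (y := fun s => cs κ (ρ s / 2)) hprofile.isOpen
      hprofile.ordConnected hprofile.nonempty (hne hκ) (fun s hs => hprofile.differentiableAt_t hs)
      (fun s hs => (hprofile.hasDerivAt_cs_half hs).differentiableAt)
      (fun s hs => (hprofile.cs_half_pos hs).ne')]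
    constructor
    · rintro ⟨H', hH', hmc, -, hI⟩
      have hH2 : H ^ 2 = H' ^ 2 := by rcases hH' with rfl | rfl <;> ring
      rw [hH2]
      exact solvesLinearODE_cs_half hκ hε hprofile
        (by rcases hH' with rfl | rfl <;> simpa using hH) hmc hI
    · intro hode
      obtain ⟨H', hH', hmc, hI⟩ := exists_hasMeanCurvature_of_cs_half hκ hε hprofile hH hode
      exact ⟨H', hH', hmc,
        (qVanishes_iff_firstIntegral hκ hε hprofile hmc hI).2 (Or.inl rfl), hI⟩
  · simp only [profileEqPlus_iff hκ hε hH]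
    rw [exists_normalForm_iff (y := fun s => sn κ (ρ s / 2)) hprofile.isOpen
      hprofile.ordConnected hprofile.nonempty (by simpa using hne one_ne_zero)
      (fun s hs => hprofile.differentiableAt_t hs)
      (fun s hs => (hprofile.hasDerivAt_sn_half hs).differentiableAt)
      (fun s hs => (hprofile.sn_half_pos hs).ne')]
    constructor
    · rintro ⟨H', hH', hmc, -, hI⟩
      have hH2 : H ^ 2 = H' ^ 2 := by rcases hH' with rfl | rfl <;> ring
      rw [hH2]
      exact solvesLinearODE_sn_half hκ hε hprofile
        (by rcases hH' with rfl | rfl <;> simpa using hH) hmc hI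
    · intro hode
      obtain ⟨H', hH', hmc, hI⟩ := exists_hasMeanCurvature_of_sn_half hκ hε hprofile hH hode
      exact ⟨H', hH', hmc,
        (qVanishes_iff_firstIntegral hκ hε hprofile hmc hI).2 (Or.inr rfl), hI⟩
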